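/- For integers $c\ge 1$ and $n\ge 0$ let $a_c(n)$ denote the number of generalized cubic partitions of $n$, i.e. partitions of $n$ in which each even part may appear in $c$ different colors and each odd part in one color (so $a_c(0)=1$); equivalently, $$\sum_{n\ge 0}a_c(n)q^n=\frac{1}{f_1f_2^{c-1}},\qquad f_k:=\prod_{i\ge 1}(1-q^{ki}).$$ Then for all $n\ge 0$, $$\begin{aligned} a_{37}(43n+12)&\equiv 0 \pmod{43},\\ a_{41}(47n+21)&\equiv 0 \pmod{47},\\ a_{53}(59n+56)&\equiv 0 \pmod{59},\\ a_{61}(67n+19)&\equiv 0 \pmod{67},\\ a_{65}(71n+32)&\equiv 0 \pmod{71},\\ a_{73}(79n+62)&\equiv 0 \pmod{79},\\ a_{77}(83n+79)&\equiv 0 \pmod{83}. \end{aligned}$$ -/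

import Mathlib

/-- The number of colours in which a part of size `k` is available in a generalized cubic
partition with parameter `c`: even parts come in `c` colours, odd parts in one colour. -/
def numColours (c k : ℕ) : ℕ := if Even k then c else 1

/-- A generalized cubic partition of `n` with parameter `c`: a finite multiset of coloured parts
`(k, j)` of positive size `k` and colour `j ∈ {0, …, numColours c k - 1}`, whose sizes add up
to `n`. -/
@[ext]
structure GeneralizedCubicPartition (c n : ℕ) where
  /-- the coloured parts, as pairs (size, colour) -/
  parts : Multiset (ℕ × ℕ)
  size_pos : ∀ x ∈ parts, 0 < x.1
  colour_lt : ∀ x ∈ parts, x.2 < numColours c x.1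
  sum_sizes : (parts.map Prod.fst).sum = n

/-- There are only finitely many generalized cubic partitions of `n`, so that counting them with
`Nat.card` is meaningful. -/
instance GeneralizedCubicPartition.finite (c n : ℕ) : Finite (GeneralizedCubicPartition c n) := by
  have hM : (Set.Iic (n • (Finset.range (n + 1) ×ˢ Finset.range (c + 1)).val)).Finite :=
    Set.finite_Iic _
  have : Finite (Set.Iic (n • (Finset.range (n + 1) ×ˢ Finset.range (c + 1)).val)) := hM
  refine Finite.of_injective (β := Set.Iic (n • (Finset.range (n + 1) ×ˢ Finset.range (c + 1)).val))
    (fun p => ⟨p.parts, ?_⟩) ?_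
  · rw [Set.mem_Iic, Multiset.le_iff_count]
    intro x
    by_cases hx : x ∈ p.parts
    · have h1 : x.1 ≤ n := by
        have := Multiset.single_le_sum (fun _ _ => Nat.zero_le _) x.1
          (Multiset.mem_map_of_mem Prod.fst hx)
        rwa [p.sum_sizes] at this
      have h2 : x.2 < c + 1 := by
        have := p.colour_lt x hx
        unfold numColours at this
        split_ifs at this <;> omega
      have h3 : Multiset.card p.parts ≤ n := by
        have := Multiset.card_nsmul_le_sum (s := p.parts.map Prod.fst) (a := 1) (by
          intro k hk
          obtain ⟨y, hy, rfl⟩ := Multiset.mem_map.1 hk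
          exact p.size_pos y hy)
        rw [p.sum_sizes] at this
        simpa using this
      have h4 : x ∈ Finset.range (n + 1) ×ˢ Finset.range (c + 1) := by
        simp only [Finset.mem_product, Finset.mem_range]
        omega
      have h5 : 1 ≤ (Finset.range (n + 1) ×ˢ Finset.range (c + 1)).val.count x :=
        Multiset.one_le_count_iff_mem.2 h4
      rw [Multiset.count_nsmul]
      have h6 := Multiset.count_le_card x p.parts
      nlinarith
    · rw [Multiset.count_eq_zero_of_notMem hx]
      exact Nat.zero_le _
  · intro p q h
    exact GeneralizedCubicPartition.ext (congrArg Subtype.val h)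

/-- `a_c(n)`, the number of generalized cubic partitions of `n` with parameter `c`; its generating
function is `∏_{k ≥ 1} 1 / ((1 - q ^ k) * (1 - q ^ (2 * k)) ^ (c - 1))` for `c ≥ 1`. -/
noncomputable def generalizedCubicCount (c n : ℕ) : ℕ :=
  Nat.card (GeneralizedCubicPartition c n)

/-! In every case c = p - 6, with p a prime ≡ 3 mod 4 and 24r ≡ -13 mod p for the residue r. Hence
the generating function 1/(f_1 f_2^(c-1)) equals (f_2^7/f_1) / f_2^p. Modulo p the series f_2^p only
involves powers of X^p, so it is enough that p divides the coefficients of X^m in f_2^7/f_1 whenever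
p ∣ 24m + 13; strong induction on n then transfers this to a_c (`generalizedCubicCount_modEq_zero`).

The divisibility comes from writing f_2^7/f_1 as the Wronskian-type expression fg + 2(f·Dg - g·Df),
D = X d/dX, in two quintuple-product theta series (`eulerProd_one_mul_wronskianSeries`). Its terms
are ±(1 + 2(b - a)) X^(a+b), where 48a + 1 = u² and 48b + 25 = v². If p ∣ 24(a+b) + 13, then p ∣ u²
+ v², so p divides u and v because p ≡ 3 mod 4, and hence p divides v² - u² = 24(1 + 2(b - a))
(`dvd_coeff_quintupleTheta_wronskian`).

For the Wronskian formula, the quintuple product identity (`theta_mul_theta_eq`) shows that the two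
series are f_1/f_2 times the theta series with exponents 4k² - k and 4k² - 3k. A common factor
leaves the Wronskian as a square, and the Wronskian of the simpler pair is a product of two of
Jacobi's cube series (`wronskian_theta_eq`, `tprod_cube`). All product expansions rest on the Jacobi
triple product, obtained from a finite version with Gaussian binomials. -/

/-! ### Gaussian binomial coefficients. -/

section GaussBinom

variable {S : Type*} [CommRing S]

/-- The Gaussian binomial coefficient `[n, j]` at `Q`, defined by its Pascal recursion. -/
def gaussBinom (Q : S) : ℕ → ℕ → S
  | _, 0 => 1
  | 0, _ + 1 => 0
  | n + 1, j + 1 => gaussBinom Q n (j + 1) + Q ^ (n - j) * gaussBinom Q n j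

/-- The finite `Q`-Pochhammer symbol `∏_{i < n} (1 - Q ^ (i + 1))`. -/
def qPoch (Q : S) (n : ℕ) : S := ∏ i ∈ Finset.range n, (1 - Q ^ (i + 1))

theorem qPoch_succ (Q : S) (n : ℕ) : qPoch Q (n + 1) = qPoch Q n * (1 - Q ^ (n + 1)) :=
  Finset.prod_range_succ _ _

theorem gaussBinom_zero_right (Q : S) (n : ℕ) : gaussBinom Q n 0 = 1 := by
  cases n <;> rfl

theorem gaussBinom_succ_succ (Q : S) (n j : ℕ) :
    gaussBinom Q (n + 1) (j + 1) = gaussBinom Q n (j + 1) + Q ^ (n - j) * gaussBinom Q n j := rfl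

theorem gaussBinom_eq_zero_of_lt (Q : S) {n j : ℕ} (h : n < j) : gaussBinom Q n j = 0 := by
  induction n generalizing j with
  | zero => obtain ⟨j, rfl⟩ := Nat.exists_eq_succ_of_ne_zero (by omega : j ≠ 0); rfl
  | succ n ih =>
    obtain ⟨j, rfl⟩ := Nat.exists_eq_succ_of_ne_zero (by omega : j ≠ 0)
    rw [Nat.succ_eq_add_one, gaussBinom_succ_succ, ih (by omega), ih (by omega)]
    simp

/-- The finite triple product needs both Pascal rules: one for a new factor in z, this one for a new
factor in z⁻¹. -/
theorem gaussBinom_succ_succ' (Q : S) (n j : ℕ) :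
    gaussBinom Q (n + 1) (j + 1) =
      gaussBinom Q n j + Q ^ (j + 1) * gaussBinom Q n (j + 1) := by
  induction n generalizing j with
  | zero =>
    cases j with
    | zero => simp [gaussBinom]
    | succ j => simp [gaussBinom]
  | succ n ih =>
    rcases Nat.lt_or_ge (n + 1) j with h | h
    · rw [gaussBinom_eq_zero_of_lt Q (by omega : n + 1 + 1 < j + 1),
        gaussBinom_eq_zero_of_lt Q (by omega : n + 1 < j),
        gaussBinom_eq_zero_of_lt Q (by omega : n + 1 < j + 1)]
      simp
    rw [gaussBinom_succ_succ Q (n + 1) j]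
    cases j with
    | zero =>
      have h1 := ih 0
      have h2 := gaussBinom_succ_succ Q n 0
      simp only [gaussBinom_zero_right, Nat.sub_zero] at h1 h2 ⊢
      linear_combination h1 - Q * h2
    | succ j =>
      rcases Nat.lt_or_ge n (j + 1) with h' | h'
      · obtain rfl : j = n := by omega
        rw [gaussBinom_eq_zero_of_lt Q (by omega : j + 1 < j + 1 + 1)]
        simp
      · have h1 := ih (j + 1)
        have h2 := ih j
        have h3 := gaussBinom_succ_succ Q n (j + 1)
        have h4 := gaussBinom_succ_succ Q n j
        rw [show n + 1 - (j + 1) = n - (j + 1) + 1 by omega]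
        rw [show n - j = n - (j + 1) + 1 by omega] at h4
        linear_combination h1 + Q ^ (n - (j + 1) + 1) * h2 - h4 - Q ^ (j + 2) * h3

theorem gaussBinom_mul_qPoch (Q : S) {n j : ℕ} (h : j ≤ n) :
    gaussBinom Q n j * (qPoch Q j * qPoch Q (n - j)) = qPoch Q n := by
  induction n generalizing j with
  | zero =>
    obtain rfl : j = 0 := by omega
    simp [gaussBinom, qPoch]
  | succ n ih =>
    cases j with
    | zero => simp [gaussBinom_zero_right, qPoch]
    | succ j =>
      have h2 := ih (j := j) (by omega)
      rw [gaussBinom_succ_succ, Nat.add_sub_add_right, qPoch_succ Q j, qPoch_succ Q n]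
      rcases Nat.lt_or_ge n (j + 1) with h' | h'
      · obtain rfl : j = n := by omega
        rw [gaussBinom_eq_zero_of_lt Q (by omega : j < j + 1)]
        simp only [Nat.sub_self, pow_zero] at h2 ⊢
        linear_combination (1 - Q ^ (j + 1)) * h2
      · have h1 := ih (j := j + 1) h'
        obtain ⟨d, rfl⟩ : ∃ d, n = j + 1 + d := ⟨n - (j + 1), by omega⟩
        have e1 : j + 1 + d - j = d + 1 := by omega
        have e2 : j + 1 + d - (j + 1) = d := by omega
        rw [e1] at h2 ⊢
        rw [e2, qPoch_succ] at h1
        rw [qPoch_succ] at h2 ⊢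
        linear_combination (1 - Q ^ (d + 1)) * h1 + Q ^ (d + 1) * (1 - Q ^ (j + 1)) * h2

/-- Allows Pochhammer symbols to be cancelled modulo x^N over any commutative ring; the dual
numbers, where it is later applied, have zero divisors. -/
theorem isCoprime_pow_qPoch (x : S) {M : ℕ} (hM : 0 < M) (N n : ℕ) :
    IsCoprime (x ^ N) (qPoch (x ^ M) n) := by
  refine IsCoprime.pow_left (IsCoprime.prod_right fun i _ => ?_)
  refine ⟨x ^ (M * (i + 1) - 1), 1, ?_⟩
  have : M * (i + 1) = (M * (i + 1) - 1) + 1 := by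
    exact (Nat.sub_add_cancel (Nat.mul_pos hM (Nat.succ_pos i))).symm
  rw [← pow_mul, ← pow_succ, ← this]
  ring

theorem dvd_qPoch_sub (x : S) {M : ℕ} (hM : 0 < M) {m n : ℕ} (h : m ≤ n) :
    x ^ (m + 1) ∣ qPoch (x ^ M) n - qPoch (x ^ M) m := by
  induction n, h using Nat.le_induction with
  | base => simp
  | succ n hmn ih =>
    rw [qPoch_succ]
    have : x ^ (m + 1) ∣ (x ^ M) ^ (n + 1) := by
      rw [← pow_mul]
      exact pow_dvd_pow _ (by nlinarith)
    obtain ⟨r, hr⟩ := this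
    obtain ⟨t, ht⟩ := ih
    exact ⟨t - qPoch (x ^ M) n * r, by linear_combination ht - qPoch (x ^ M) n * hr⟩

end GaussBinom

/-! ### The Jacobi triple product, finite and modulo x^N. -/

section TripleProduct

variable {S : Type*} [CommRing S]

/-- Each new factor splits the sum in two, and a Pascal rule recombines the halves after an index
shift. Stating the exponent through 2e keeps it a natural number without division. -/
theorem prod_mul_prod_eq_sum_gaussBinom (x : S) (z : Sˣ) {a b : ℕ} {e : ℤ → ℕ}
    (he : ∀ k : ℤ, 2 * (e k : ℤ) = (a + b) * k ^ 2 + (a - b) * k) (m n : ℕ) :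
    (∏ i ∈ Finset.range m, (1 + (z : S) * x ^ (a + (a + b) * i))) *
        ∏ i ∈ Finset.range n, (1 + ((z⁻¹ : Sˣ) : S) * x ^ (b + (a + b) * i)) =
      ∑ j ∈ Finset.range (m + n + 1), gaussBinom (x ^ (a + b)) (m + n) j *
        (((z ^ ((j : ℤ) - n) : Sˣ) : S) * x ^ e (j - n)) := by
  induction m with
  | zero =>
    simp only [Finset.range_zero, Finset.prod_empty, one_mul, zero_add]
    induction n with
    | zero =>
      have := he 0
      simp [gaussBinom] at this ⊢
      simp [this]
    | succ n ih =>
      rw [Finset.prod_range_succ, ih, Finset.sum_range_succ' _ (n + 1)]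
      have key : ∀ j ∈ Finset.range (n + 1), gaussBinom (x ^ (a + b)) (n + 1) (j + 1) *
          (((z ^ (((j + 1 : ℕ) : ℤ) - (n + 1 : ℕ)) : Sˣ) : S) *
            x ^ e (((j + 1 : ℕ) : ℤ) - (n + 1 : ℕ))) =
          gaussBinom (x ^ (a + b)) n j * (((z ^ ((j : ℤ) - n) : Sˣ) : S) * x ^ e (j - n)) +
          gaussBinom (x ^ (a + b)) n (j + 1) * (((z ^ (((j + 1 : ℕ) : ℤ) - n) : Sˣ) : S) *
            x ^ e (((j + 1 : ℕ) : ℤ) - n)) *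
            (((z⁻¹ : Sˣ) : S) * x ^ (b + (a + b) * n)) := by
        intro j hj
        have hj' := Finset.mem_range.1 hj
        have e1 : (((j + 1 : ℕ) : ℤ) - (n + 1 : ℕ)) = (j : ℤ) - n := by push_cast; ring
        have e2 : (a + b) * (j + 1) + e ((j : ℤ) - n) =
            e (((j + 1 : ℕ) : ℤ) - n) + (b + (a + b) * n) := by
          have h1 := he ((j : ℤ) - n)
          have h2 := he (((j + 1 : ℕ) : ℤ) - n)
          zify
          push_cast at h1 h2 ⊢
          linarith
        have e3 : ((z ^ ((j : ℤ) - n) : Sˣ) : S) =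
            ((z ^ (((j + 1 : ℕ) : ℤ) - n) : Sˣ) : S) * ((z⁻¹ : Sˣ) : S) := by
          rw [← Units.val_mul, ← zpow_sub_one]
          congr 2
          push_cast
          ring
        rw [e1, gaussBinom_succ_succ', add_mul]
        congr 1
        calc _ = gaussBinom (x ^ (a + b)) n (j + 1) * ((z ^ ((j : ℤ) - n) : Sˣ) : S) *
              x ^ ((a + b) * (j + 1) + e ((j : ℤ) - n)) := by
              rw [pow_add x ((a + b) * (j + 1)), pow_mul x (a + b)]; ring
          _ = _ := by rw [e2, e3, pow_add]; ring
      rw [Finset.sum_congr rfl key, Finset.sum_add_distrib, ← Finset.sum_mul,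
        mul_add, mul_one, add_assoc]
      congr 1
      have h0 := Finset.sum_range_succ' (fun j : ℕ => gaussBinom (x ^ (a + b)) n j *
        (((z ^ ((j : ℤ) - n) : Sˣ) : S) * x ^ e (j - n))) (n + 1)
      rw [Finset.sum_range_succ, gaussBinom_eq_zero_of_lt _ (Nat.lt_succ_self n)] at h0
      simp only [zero_mul, add_zero] at h0
      rw [h0, add_mul]
      congr 1
      rw [gaussBinom_zero_right, gaussBinom_zero_right]
      have e2 : e (((0 : ℕ) : ℤ) - n) + (b + (a + b) * n) = e (((0 : ℕ) : ℤ) - (n + 1 : ℕ)) := by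
        have h1 := he (((0 : ℕ) : ℤ) - n)
        have h2 := he (((0 : ℕ) : ℤ) - (n + 1 : ℕ))
        zify
        push_cast at h1 h2 ⊢
        linarith
      have e3 : ((z ^ (((0 : ℕ) : ℤ) - (n + 1 : ℕ)) : Sˣ) : S) =
          ((z ^ (((0 : ℕ) : ℤ) - n) : Sˣ) : S) * ((z⁻¹ : Sˣ) : S) := by
        rw [← Units.val_mul, ← zpow_sub_one]
        congr 2
        push_cast
        ring
      rw [← e2, e3, pow_add]
      ring
  | succ m ih =>
    rw [Finset.prod_range_succ, mul_right_comm, ih,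
      show m + 1 + n = (m + n) + 1 by ring, Finset.sum_range_succ' _ (m + n + 1)]
    have key : ∀ j ∈ Finset.range (m + n + 1), gaussBinom (x ^ (a + b)) (m + n + 1) (j + 1) *
        (((z ^ (((j + 1 : ℕ) : ℤ) - n) : Sˣ) : S) * x ^ e (((j + 1 : ℕ) : ℤ) - n)) =
        gaussBinom (x ^ (a + b)) (m + n) (j + 1) *
          (((z ^ (((j + 1 : ℕ) : ℤ) - n) : Sˣ) : S) * x ^ e (((j + 1 : ℕ) : ℤ) - n)) +
        gaussBinom (x ^ (a + b)) (m + n) j * (((z ^ ((j : ℤ) - n) : Sˣ) : S) * x ^ e (j - n)) *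
          ((z : S) * x ^ (a + (a + b) * m)) := by
      intro j hj
      have hj' := Finset.mem_range.1 hj
      have e2 : (a + b) * (m + n - j) + e (((j + 1 : ℕ) : ℤ) - n) =
          e ((j : ℤ) - n) + (a + (a + b) * m) := by
        have h1 := he ((j : ℤ) - n)
        have h2 := he (((j + 1 : ℕ) : ℤ) - n)
        have h3 : ((m + n - j : ℕ) : ℤ) = m + n - j := by
          rw [Nat.cast_sub (by omega)]; push_cast; ring
        zify
        rw [h3]
        push_cast at h1 h2 ⊢
        linarith
      have e3 : ((z ^ (((j + 1 : ℕ) : ℤ) - n) : Sˣ) : S) =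
          ((z ^ ((j : ℤ) - n) : Sˣ) : S) * (z : S) := by
        rw [← Units.val_mul, ← zpow_add_one]
        congr 2
        push_cast
        ring
      rw [gaussBinom_succ_succ, add_mul]
      congr 1
      calc _ = gaussBinom (x ^ (a + b)) (m + n) j * ((z ^ (((j + 1 : ℕ) : ℤ) - n) : Sˣ) : S) *
            x ^ ((a + b) * (m + n - j) + e (((j + 1 : ℕ) : ℤ) - n)) := by
              rw [pow_add x ((a + b) * (m + n - j)), pow_mul x (a + b)]; ring
        _ = _ := by rw [e2, e3, pow_add]; ring
    have h0 := Finset.sum_range_succ' (fun j : ℕ => gaussBinom (x ^ (a + b)) (m + n) j *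
      (((z ^ ((j : ℤ) - n) : Sˣ) : S) * x ^ e (j - n))) (m + n + 1)
    rw [Finset.sum_range_succ, gaussBinom_eq_zero_of_lt _ (Nat.lt_succ_self (m + n))] at h0
    simp only [zero_mul, add_zero] at h0
    rw [Finset.sum_congr rfl key, Finset.sum_add_distrib, ← Finset.sum_mul]
    rw [gaussBinom_zero_right] at h0 ⊢
    linear_combination h0

/-- A quadratic exponent grows at least linearly. -/
theorem abs_le_of_two_mul_eq {a b : ℕ} (hab : 0 < a + b) {e : ℤ → ℕ}
    (he : ∀ k : ℤ, 2 * (e k : ℤ) = (a + b) * k ^ 2 + (a - b) * k) (k : ℤ) :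
    |k| ≤ e k + 1 := by
  have h := he k
  have hab' : (1 : ℤ) ≤ a + b := by exact_mod_cast hab
  have ha : (0 : ℤ) ≤ a := Nat.cast_nonneg a
  have hb : (0 : ℤ) ≤ b := Nat.cast_nonneg b
  rcases le_or_gt 0 k with hk | hk
  · rw [abs_of_nonneg hk]
    rcases eq_or_lt_of_le hk with rfl | hk1
    · positivity
    have h1 : 0 ≤ k * (k - 1) := mul_nonneg hk (by omega)
    have h2 : 0 ≤ (k - 1) * (k - 2) := by
      rcases eq_or_lt_of_le (show (1 : ℤ) ≤ k from hk1) with rfl | hk2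
      · simp
      · exact mul_nonneg (by omega) (by omega)
    nlinarith [mul_nonneg ha hk, mul_nonneg (sub_nonneg.2 hab') h1]
  · rw [abs_of_neg hk]
    have h1 : 0 ≤ -k * (-k - 1) := mul_nonneg (by omega) (by omega)
    have h2 : 0 ≤ (-k - 1) * (-k - 2) := by
      rcases eq_or_lt_of_le (show k ≤ -1 by omega) with rfl | hk2
      · simp
      · exact mul_nonneg (by omega) (by omega)
    nlinarith [mul_nonneg hb (neg_nonneg.2 hk.le), mul_nonneg (sub_nonneg.2 hab') h1]

/-- The Jacobi triple product, modulo `x ^ N`. -/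
theorem pow_dvd_tripleProduct_sub_sum (x : S) (z : Sˣ) {a b : ℕ} (hab : 0 < a + b) {e : ℤ → ℕ}
    (he : ∀ k : ℤ, 2 * (e k : ℤ) = (a + b) * k ^ 2 + (a - b) * k) (N : ℕ) :
    x ^ N ∣ (∏ i ∈ Finset.range N, ((1 + (z : S) * x ^ (a + (a + b) * i)) *
        (1 + ((z⁻¹ : Sˣ) : S) * x ^ (b + (a + b) * i)) * (1 - x ^ ((a + b) * (i + 1))))) -
      ∑ k ∈ Finset.Icc (-N : ℤ) N, ((z ^ k : Sˣ) : S) * x ^ e k := by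
  have hI : ∑ k ∈ Finset.Icc (-N : ℤ) N, ((z ^ k : Sˣ) : S) * x ^ e k =
      ∑ j ∈ Finset.range (N + N + 1), ((z ^ ((j : ℤ) - N) : Sˣ) : S) * x ^ e (j - N) := by
    symm
    refine Finset.sum_bij (fun j _ => (j : ℤ) - N) ?_ ?_ ?_ ?_
    · intro j hj
      simp only [Finset.mem_range, Finset.mem_Icc] at hj ⊢
      omega
    · intro i _ j _ h
      simpa using h
    · intro k hk
      simp only [Finset.mem_Icc] at hk
      exact ⟨(k + N).toNat, by simp; omega, by simp; omega⟩
    · intros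
      rfl
  have hP : ∏ i ∈ Finset.range N, (1 - x ^ ((a + b) * (i + 1))) = qPoch (x ^ (a + b)) N :=
    Finset.prod_congr rfl fun i _ => by rw [pow_mul]
  rw [hI, Finset.prod_mul_distrib, Finset.prod_mul_distrib, hP,
    prod_mul_prod_eq_sum_gaussBinom x z he, Finset.sum_mul, ← Finset.sum_sub_distrib]
  refine Finset.dvd_sum fun j hj => ?_
  have hj' : j ≤ N + N := Nat.lt_succ_iff.1 (Finset.mem_range.1 hj)
  set q := x ^ (a + b) with hq
  set m := min j (N + N - j) with hm
  -- All four Pochhammer symbols involved agree with `qPoch q m` modulo x^(m+1), and those of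
  -- lengths j and 2N - j can be cancelled.
  have h1 : x ^ (m + 1) ∣ gaussBinom q (N + N) j * qPoch q N - 1 := by
    refine (isCoprime_pow_qPoch x hab (m + 1) j).dvd_of_dvd_mul_left
      ((isCoprime_pow_qPoch x hab (m + 1) (N + N - j)).dvd_of_dvd_mul_left ?_)
    rw [← hq]
    have e1 := gaussBinom_mul_qPoch q hj'
    obtain ⟨r1, d1⟩ := dvd_qPoch_sub x hab (show m ≤ N by omega)
    obtain ⟨r2, d2⟩ := dvd_qPoch_sub x hab (show m ≤ N + N by omega)
    obtain ⟨r3, d3⟩ := dvd_qPoch_sub x hab (show m ≤ j by omega)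
    obtain ⟨r4, d4⟩ := dvd_qPoch_sub x hab (show m ≤ N + N - j by omega)
    rw [← hq] at d1 d2 d3 d4
    refine ⟨r1 * qPoch q (N + N) + qPoch q m * r2 - r3 * qPoch q (N + N - j) - qPoch q m * r4, ?_⟩
    linear_combination qPoch q N * e1 + d1 * qPoch q (N + N) + d2 * qPoch q m -
      d3 * qPoch q (N + N - j) - d4 * qPoch q m
  -- Here m = N - |j - N|, and the exponent is at least |j - N| - 1.
  have h2 : N ≤ (m + 1) + e ((j : ℤ) - N) := by
    have := abs_le.1 (abs_le_of_two_mul_eq hab he ((j : ℤ) - N))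
    omega
  have h3 : gaussBinom q (N + N) j * (((z ^ ((j : ℤ) - N) : Sˣ) : S) * x ^ e (j - N)) *
      qPoch q N - ((z ^ ((j : ℤ) - N) : Sˣ) : S) * x ^ e (j - N) =
      ((gaussBinom q (N + N) j * qPoch q N - 1) * x ^ e (j - N)) *
        ((z ^ ((j : ℤ) - N) : Sˣ) : S) := by ring
  rw [h3]
  exact (pow_dvd_pow x h2).trans (pow_add x _ _ ▸ (mul_dvd_mul_right h1 _).trans (dvd_mul_right _ _))

end TripleProduct

/-! ### Integer power series indexed by families of exponents. -/

section ExponentSeries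

open PowerSeries

variable {ι κ : Type*}

/-- The power series `∑ i, c i * X ^ e i`, for exponents `e` with finite fibres. -/
noncomputable def exponentSeries (e : ι → ℕ) (c : ι → ℤ) : ℤ⟦X⟧ :=
  PowerSeries.mk fun n => ∑ᶠ i, if e i = n then c i else 0

/-- Every bound on the exponents holds for finitely many indices only. -/
def FiniteBelow (e : ι → ℕ) : Prop := ∀ n, {i | e i ≤ n}.Finite

theorem coeff_exponentSeries (e : ι → ℕ) (c : ι → ℤ) (n : ℕ) :
    coeff n (exponentSeries e c) = ∑ᶠ i, if e i = n then c i else 0 := coeff_mk _ _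

theorem coeff_exponentSeries_eq_sum {e : ι → ℕ} (c : ι → ℤ) {n : ℕ} {s : Finset ι}
    (hs : ∀ i, e i = n → i ∈ s) :
    coeff n (exponentSeries e c) = coeff n (∑ i ∈ s, C (c i) * X ^ e i : ℤ⟦X⟧) := by
  rw [coeff_exponentSeries, map_sum]
  rw [finsum_eq_sum_of_support_subset (s := s)]
  · refine Finset.sum_congr rfl fun i _ => ?_
    rw [coeff_C_mul, coeff_X_pow, mul_ite, mul_one, mul_zero]
    simp only [eq_comm]
  · intro i hi
    refine hs i ?_
    by_contra h
    simp [h] at hi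

theorem pow_dvd_exponentSeries_sub {e : ι → ℕ} (c : ι → ℤ) {N : ℕ} {s : Finset ι}
    (hs : ∀ i, e i < N → i ∈ s) :
    (X : ℤ⟦X⟧) ^ N ∣ exponentSeries e c - ∑ i ∈ s, C (c i) * X ^ e i := by
  rw [X_pow_dvd_iff]
  intro n hn
  rw [map_sub, coeff_exponentSeries_eq_sum c (s := s) fun i hi => hs i (by omega), sub_self]

theorem FiniteBelow.add {e : ι → ℕ} {e' : κ → ℕ} (he : FiniteBelow e) (he' : FiniteBelow e') :
    FiniteBelow fun p : ι × κ => e p.1 + e' p.2 := fun n =>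
  ((he n).prod (he' n)).subset fun p hp => by
    simp only [Set.mem_ofPred_eq, Set.mem_prod] at hp ⊢
    omega

theorem FiniteBelow.sumElim {e : ι → ℕ} {e' : κ → ℕ} (he : FiniteBelow e)
    (he' : FiniteBelow e') : FiniteBelow (Sum.elim e e') := fun n =>
  (((he n).image Sum.inl).union ((he' n).image Sum.inr)).subset fun p hp => by
    cases p with
    | inl i => exact Or.inl ⟨i, hp, rfl⟩
    | inr i => exact Or.inr ⟨i, hp, rfl⟩

theorem exponentSeries_mul {e : ι → ℕ} {e' : κ → ℕ} (he : FiniteBelow e) (he' : FiniteBelow e')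
    (c : ι → ℤ) (c' : κ → ℤ) :
    exponentSeries e c * exponentSeries e' c' =
      exponentSeries (fun p : ι × κ => e p.1 + e' p.2) fun p => c p.1 * c' p.2 := by
  ext n
  rw [coeff_exponentSeries_eq_sum _ (s := (he n).toFinset ×ˢ (he' n).toFinset)]
  · have h : ∑ p ∈ (he n).toFinset ×ˢ (he' n).toFinset,
        (C (c p.1 * c' p.2) * X ^ (e p.1 + e' p.2) : ℤ⟦X⟧) =
        (∑ i ∈ (he n).toFinset, C (c i) * X ^ e i) *
          ∑ j ∈ (he' n).toFinset, C (c' j) * X ^ e' j := by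
      rw [Finset.sum_mul_sum, Finset.sum_product]
      refine Finset.sum_congr rfl fun i _ => Finset.sum_congr rfl fun j _ => ?_
      rw [map_mul, pow_add]
      ring
    rw [h, coeff_mul, coeff_mul]
    refine Finset.sum_congr rfl fun p hp => ?_
    have hp' := Finset.HasAntidiagonal.mem_antidiagonal.1 hp
    rw [coeff_exponentSeries_eq_sum c, coeff_exponentSeries_eq_sum c']
    · intro i hi
      simp only [Set.Finite.mem_toFinset, Set.mem_ofPred_eq]
      omega
    · intro i hi
      simp only [Set.Finite.mem_toFinset, Set.mem_ofPred_eq]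
      omega
  · intro p hp
    simp only [Finset.mem_product, Set.Finite.mem_toFinset, Set.mem_ofPred_eq]
    omega

theorem exponentSeries_comp (σ : κ ≃ ι) (e : ι → ℕ) (c : ι → ℤ) :
    exponentSeries (e ∘ σ) (c ∘ σ) = exponentSeries e c := by
  ext n
  rw [coeff_exponentSeries, coeff_exponentSeries]
  exact finsum_comp_equiv (f := fun i => if e i = n then c i else 0) σ

theorem exponentSeries_comp_bijective {σ : κ → ι} (hσ : Function.Bijective σ) (e : ι → ℕ)
    (c : ι → ℤ) : exponentSeries (fun i => e (σ i)) (fun i => c (σ i)) = exponentSeries e c :=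
  exponentSeries_comp (Equiv.ofBijective σ hσ) e c

theorem exponentSeries_finite_support {e : ι → ℕ} (he : FiniteBelow e) (c : ι → ℤ) (n : ℕ) :
    (Function.support fun i => if e i = n then c i else 0).Finite :=
  (he n).subset fun i hi => by
    by_contra h
    have : e i ≠ n := fun h' => h h'.le
    simp [this] at hi

theorem exponentSeries_add {e : ι → ℕ} (he : FiniteBelow e) (c c' : ι → ℤ) :
    exponentSeries e c + exponentSeries e c' = exponentSeries e fun i => c i + c' i := by
  ext n
  rw [map_add, coeff_exponentSeries, coeff_exponentSeries, coeff_exponentSeries,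
    ← finsum_add_distrib (exponentSeries_finite_support he c n)
      (exponentSeries_finite_support he c' n)]
  refine finsum_congr fun i => ?_
  split_ifs <;> simp

theorem exponentSeries_smul (e : ι → ℕ) (a : ℤ) (c : ι → ℤ) :
    C a * exponentSeries e c = exponentSeries e fun i => a * c i := by
  ext n
  rw [coeff_C_mul, coeff_exponentSeries, coeff_exponentSeries]
  rw [← smul_eq_mul, smul_finsum]
  refine finsum_congr fun i => ?_
  split_ifs <;> simp

theorem exponentSeries_sumElim {e : ι → ℕ} {e' : κ → ℕ} (he : FiniteBelow e)
    (he' : FiniteBelow e') (c : ι → ℤ) (c' : κ → ℤ) :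
    exponentSeries (Sum.elim e e') (Sum.elim c c') =
      exponentSeries e c + exponentSeries e' c' := by
  ext n
  rw [map_add, coeff_exponentSeries_eq_sum _ (s := (he n).toFinset.disjSum (he' n).toFinset),
    coeff_exponentSeries_eq_sum c (s := (he n).toFinset),
    coeff_exponentSeries_eq_sum c' (s := (he' n).toFinset), Finset.sum_disjSum, map_add]
  · rfl
  · simp +contextual
  · simp +contextual
  · rintro (i | i) <;> simp +contextual

theorem exponentSeries_eq_zero_of_involution {e : ι → ℕ} {c : ι → ℤ} (σ : ι ≃ ι)
    (he : ∀ i, e (σ i) = e i) (hc : ∀ i, c (σ i) = -c i) : exponentSeries e c = 0 := by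
  have h := exponentSeries_comp σ e c
  have h1 : e ∘ σ = e := funext he
  have h2 : exponentSeries e (c ∘ σ) = C (-1) * exponentSeries e c := by
    rw [exponentSeries_smul]
    congr 1
    funext i
    simp [hc]
  rw [h1, h2] at h
  ext n
  have := congrArg (coeff n) h
  rw [coeff_C_mul] at this
  simp
  omega

/-- The operator `X * d/dX`. -/
noncomputable def eulerDeriv (f : ℤ⟦X⟧) : ℤ⟦X⟧ := X * derivative ℤ f

theorem coeff_eulerDeriv (f : ℤ⟦X⟧) (n : ℕ) : coeff n (eulerDeriv f) = n * coeff n f := by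
  unfold eulerDeriv
  cases n with
  | zero => simp
  | succ n =>
    rw [coeff_succ_X_mul]
    simp [coeff_derivative, mul_comm]

theorem eulerDeriv_mul (f g : ℤ⟦X⟧) :
    eulerDeriv (f * g) = f * eulerDeriv g + eulerDeriv f * g := by
  simp only [eulerDeriv, Derivation.leibniz, smul_eq_mul]
  ring

theorem eulerDeriv_exponentSeries (e : ι → ℕ) (c : ι → ℤ) :
    eulerDeriv (exponentSeries e c) = exponentSeries e fun i => (e i : ℤ) * c i := by
  ext n
  rw [coeff_eulerDeriv, coeff_exponentSeries, coeff_exponentSeries]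
  rw [← smul_eq_mul, smul_finsum]
  refine finsum_congr fun i => ?_
  split_ifs with h
  · simp [h]
  · simp

/-- A Wronskian of `f` and `g`, normalised by a multiple of `f * g`. -/
noncomputable def wronskianSeries (f g : ℤ⟦X⟧) : ℤ⟦X⟧ :=
  f * g + 2 * (f * eulerDeriv g - g * eulerDeriv f)

/-- The terms containing the derivative of h cancel by antisymmetry. -/
theorem wronskianSeries_mul_mul (h f g : ℤ⟦X⟧) :
    wronskianSeries (h * f) (h * g) = h ^ 2 * wronskianSeries f g := by
  simp only [wronskianSeries, eulerDeriv_mul]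
  ring

theorem wronskianSeries_exponentSeries {e : ι → ℕ} {e' : κ → ℕ} (he : FiniteBelow e)
    (he' : FiniteBelow e') (c : ι → ℤ) (c' : κ → ℤ) :
    wronskianSeries (exponentSeries e c) (exponentSeries e' c') =
      exponentSeries (fun p : ι × κ => e p.1 + e' p.2)
        fun p => c p.1 * c' p.2 * (1 + 2 * (e' p.2 - e p.1)) := by
  have h : wronskianSeries (exponentSeries e c) (exponentSeries e' c') =
      exponentSeries e c * exponentSeries e' c' + (C 2 * (exponentSeries e c *
        eulerDeriv (exponentSeries e' c')) + C (-2) * (eulerDeriv (exponentSeries e c) *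
          exponentSeries e' c')) := by
    simp only [wronskianSeries, map_neg, map_ofNat]
    ring
  rw [h, eulerDeriv_exponentSeries, eulerDeriv_exponentSeries, exponentSeries_mul he he',
    exponentSeries_mul he he', exponentSeries_mul he he', exponentSeries_smul,
    exponentSeries_smul, exponentSeries_add (he.add he'), exponentSeries_add (he.add he')]
  congr 1
  funext p
  ring

end ExponentSeries

/-! ### Infinite products over arithmetic progressions. -/

section ProgressionProduct

open PowerSeries
open scoped PowerSeries.WithPiTopology

/-- The infinite product `∏_{i ≥ 0} (1 + s * X ^ (a + M * i))`, for a sign `s`. -/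
noncomputable def progProd (s : ℤˣ) (a M : ℕ) : ℤ⟦X⟧ :=
  ∏' i : ℕ, (1 + C (s : ℤ) * X ^ (a + M * i))

theorem multipliable_one_add_of_dvd {F : ℕ → ℤ⟦X⟧} (h : ∀ i, (X : ℤ⟦X⟧) ^ i ∣ F i) :
    Multipliable fun i => 1 + F i := by
  refine WithPiTopology.multipliable_one_add_of_tendsto_order_atTop_nhds_top ℤ ?_
  refine ENat.tendsto_nhds_top_iff_natCast_lt.mpr fun n => Filter.eventually_atTop.mpr
    ⟨n + 1, fun m hm => ?_⟩
  have h1 : ((n + 1 : ℕ) : ℕ∞) ≤ (F m).order := by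
    exact nat_le_order _ _ (X_pow_dvd_iff.1 ((pow_dvd_pow _ hm).trans (h m)))
  exact lt_of_lt_of_le (by exact_mod_cast Nat.lt_succ_self n) h1

theorem multipliable_progProd (s : ℤˣ) (a : ℕ) {M : ℕ} (hM : 0 < M) :
    Multipliable fun i : ℕ => (1 + C (s : ℤ) * X ^ (a + M * i) : ℤ⟦X⟧) :=
  multipliable_one_add_of_dvd fun i =>
    (pow_dvd_pow _ (by nlinarith)).trans (dvd_mul_left _ _)

theorem tendsto_of_pow_dvd {u : ℕ → ℤ⟦X⟧} {S : ℤ⟦X⟧} (h : ∀ N, (X : ℤ⟦X⟧) ^ N ∣ u N - S) :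
    Filter.Tendsto u Filter.atTop (nhds S) := by
  rw [WithPiTopology.tendsto_iff_coeff_tendsto]
  intro n
  refine tendsto_const_nhds.congr' (Filter.eventually_atTop.2 ⟨n + 1, fun N hN => ?_⟩)
  have := X_pow_dvd_iff.1 (h N) n (by omega)
  rw [map_sub] at this
  exact (sub_eq_zero.1 this).symm

theorem tprod_eq_of_pow_dvd {F : ℕ → ℤ⟦X⟧} (hF : Multipliable F) {S : ℤ⟦X⟧}
    (h : ∀ N, (X : ℤ⟦X⟧) ^ N ∣ ∏ i ∈ Finset.range N, F i - S) : ∏' i, F i = S :=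
  tendsto_nhds_unique hF.hasProd.tendsto_prod_nat (tendsto_of_pow_dvd h)

theorem progProd_mul_progProd_two (s : ℤˣ) (a : ℕ) {M : ℕ} (hM : 0 < M) :
    progProd s a (2 * M) * progProd s (a + M) (2 * M) = progProd s a M := by
  have h := tprod_even_mul_odd (f := fun i : ℕ => (1 + C (s : ℤ) * X ^ (a + M * i) : ℤ⟦X⟧))
    (by
      convert multipliable_progProd s a (show 0 < 2 * M by omega) using 5 with i
      ring)
    (by
      convert multipliable_progProd s (a + M) (show 0 < 2 * M by omega) using 5 with i
      ring)
  rw [progProd, progProd, progProd, ← h]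
  congr 1
  · refine tprod_congr fun i => ?_
    ring_nf
  · refine tprod_congr fun i => ?_
    ring_nf

theorem progProd_mul_progProd_three (s : ℤˣ) (a : ℕ) {M : ℕ} (hM : 0 < M) :
    progProd s a (3 * M) * progProd s (a + M) (3 * M) * progProd s (a + 2 * M) (3 * M) =
      progProd s a M := by
  have h0 := (multipliable_progProd s a hM).hasProd.tendsto_prod_nat
  have h1 := (multipliable_progProd s a (show 0 < 3 * M by omega)).hasProd.tendsto_prod_nat
  have h2 := (multipliable_progProd s (a + M) (show 0 < 3 * M by omega)).hasProd.tendsto_prod_nat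
  have h3 := (multipliable_progProd s (a + 2 * M)
    (show 0 < 3 * M by omega)).hasProd.tendsto_prod_nat
  have h4 : Filter.Tendsto (fun n : ℕ => 3 * n) Filter.atTop Filter.atTop :=
    Filter.tendsto_id.const_mul_atTop' (by norm_num)
  refine tendsto_nhds_unique ((h1.mul h2).mul h3) ((h0.comp h4).congr fun n => ?_)
  simp only [Function.comp]
  induction n with
  | zero => simp
  | succ n ih =>
    rw [show 3 * (n + 1) = 3 * n + 1 + 1 + 1 by ring, Finset.prod_range_succ,
      Finset.prod_range_succ, Finset.prod_range_succ, ih, Finset.prod_range_succ,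
      Finset.prod_range_succ, Finset.prod_range_succ]
    ring

theorem progProd_one_mul_progProd_neg_one (a : ℕ) {M : ℕ} (hM : 0 < M) :
    progProd 1 a M * progProd (-1) a M = progProd (-1) (2 * a) (2 * M) := by
  rw [progProd, progProd, progProd,
    ← (multipliable_progProd 1 a hM).tprod_mul (multipliable_progProd (-1) a hM)]
  refine tprod_congr fun i => ?_
  simp
  ring

theorem progProd_ne_zero (s : ℤˣ) {a M : ℕ} (ha : 0 < a) (hM : 0 < M) : progProd s a M ≠ 0 := by
  intro h
  have h1 := congrArg (constantCoeff (R := ℤ)) h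
  rw [progProd, (multipliable_progProd s a hM).map_tprod _
    (WithPiTopology.continuous_constantCoeff ℤ)] at h1
  have h2 : ∀ i, ¬ (a + M * i = 0) := fun i => by omega
  have h3 : ∀ i, constantCoeff (1 + C (s : ℤ) * X ^ (a + M * i) : ℤ⟦X⟧) = 1 := fun i => by
    rw [map_add, map_mul, map_pow, constantCoeff_X, zero_pow (h2 i), mul_zero, map_one, add_zero]
  rw [tprod_congr h3, tprod_one, map_zero] at h1
  exact one_ne_zero h1

/-- Supplies the unit z that the triple product requires when z is a constant sign. -/
theorem exists_units_C (s : ℤˣ) :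
    ∃ u : ℤ⟦X⟧ˣ, ∀ k : ℤ, ((u ^ k : ℤ⟦X⟧ˣ) : ℤ⟦X⟧) = C ((s ^ k : ℤˣ) : ℤ) :=
  ⟨Units.map ((C (R := ℤ) : ℤ →+* ℤ⟦X⟧) : ℤ →* ℤ⟦X⟧) s, fun k => by
    rw [← map_zpow, Units.coe_map]
    rfl⟩

/-- The Jacobi triple product identity, specialised to a sign and powers of `X`. -/
theorem tripleProduct (s : ℤˣ) {a b M : ℕ} (hab : a + b = M) (hM : 0 < M) {e : ℤ → ℕ}
    (he : ∀ k : ℤ, 2 * (e k : ℤ) = (a + b) * k ^ 2 + (a - b) * k) :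
    progProd s a M * progProd s b M * progProd (-1) M M =
      exponentSeries e fun k => ((s ^ k : ℤˣ) : ℤ) := by
  subst hab
  have m1 := multipliable_progProd s a hM
  have m2 := multipliable_progProd s b hM
  have m3 := multipliable_progProd (-1) (a + b) hM
  have m4 := m1.mul m2
  rw [progProd, progProd, progProd, ← m1.tprod_mul m2, ← m4.tprod_mul m3]
  refine tprod_eq_of_pow_dvd (m4.mul m3) fun N => ?_
  obtain ⟨u, hu⟩ := exists_units_C s
  have h1 := pow_dvd_tripleProduct_sub_sum (X : ℤ⟦X⟧) u hM he N
  have h2 := pow_dvd_exponentSeries_sub (e := e) (fun k => ((s ^ k : ℤˣ) : ℤ)) (N := N)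
    (s := Finset.Icc (-N : ℤ) N) (by
      intro k hk
      have := abs_le.1 (abs_le_of_two_mul_eq hM he k)
      rw [Finset.mem_Icc]
      omega)
  simp only [hu] at h1
  have h4 := dvd_sub h1 h2
  rw [sub_sub_sub_cancel_right] at h4
  have h5 : (u : ℤ⟦X⟧) = C (s : ℤ) := by simpa only [zpow_one] using hu 1
  have h6 : ((u⁻¹ : ℤ⟦X⟧ˣ) : ℤ⟦X⟧) = C (s : ℤ) := by
    have := hu (-1)
    rwa [zpow_neg_one, zpow_neg_one, Int.units_inv_eq_self] at this
  have h7 : ∀ i : ℕ, (1 + C (s : ℤ) * X ^ (a + (a + b) * i)) *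
      (1 + C (s : ℤ) * X ^ (b + (a + b) * i)) *
      (1 + C ((-1 : ℤˣ) : ℤ) * X ^ (a + b + (a + b) * i)) =
      ((1 + (u : ℤ⟦X⟧) * X ^ (a + (a + b) * i)) *
      (1 + ((u⁻¹ : ℤ⟦X⟧ˣ) : ℤ⟦X⟧) * X ^ (b + (a + b) * i)) * (1 - X ^ ((a + b) * (i + 1)))) := by
    intro i
    rw [h5, h6, Units.val_neg, Units.val_one, map_neg, map_one, neg_one_mul, ← sub_eq_add_neg,
      mul_add (a + b), mul_one, add_comm ((a + b) * i)]
  rw [Finset.prod_congr rfl fun i _ => h7 i]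
  exact h4

end ProgressionProduct

/-! ### Jacobi's identity for the cube of Euler's product. -/

section JacobiCube

variable {S : Type*} [CommRing S]

/-- The unit `-(1 + ε)` of the dual numbers. -/
def dualUnit (S : Type*) [CommRing S] : (DualNumber S)ˣ where
  val := TrivSqZeroExt.inl (-1) + TrivSqZeroExt.inr (-1)
  inv := TrivSqZeroExt.inl (-1) + TrivSqZeroExt.inr 1
  val_inv := by ext <;> simp
  inv_val := by ext <;> simp

theorem fst_snd_dualUnit_zpow (k : ℤ) :
    TrivSqZeroExt.fst ((dualUnit S ^ k : (DualNumber S)ˣ) : DualNumber S) =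
      (((-1 : ℤˣ) ^ k : ℤˣ) : ℤ) ∧
    TrivSqZeroExt.snd ((dualUnit S ^ k : (DualNumber S)ˣ) : DualNumber S) =
      ((((-1 : ℤˣ) ^ k : ℤˣ) : ℤ) : S) * k := by
  have f1 : TrivSqZeroExt.fst ((dualUnit S : (DualNumber S)ˣ) : DualNumber S) = -1 := by simp [dualUnit]
  have f2 : TrivSqZeroExt.snd ((dualUnit S : (DualNumber S)ˣ) : DualNumber S) = -1 := by simp [dualUnit]
  have f3 : TrivSqZeroExt.fst (((dualUnit S)⁻¹ : (DualNumber S)ˣ) : DualNumber S) = -1 := by simp [dualUnit]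
  have f4 : TrivSqZeroExt.snd (((dualUnit S)⁻¹ : (DualNumber S)ˣ) : DualNumber S) = 1 := by simp [dualUnit]
  induction k with
  | zero => simp
  | succ k ih =>
    rw [zpow_add_one, Units.val_mul, TrivSqZeroExt.fst_mul, TrivSqZeroExt.snd_mul, ih.1, ih.2,
      f1, f2, zpow_add_one]
    push_cast
    simp
    ring
  | pred k ih =>
    rw [zpow_sub_one, Units.val_mul, TrivSqZeroExt.fst_mul, TrivSqZeroExt.snd_mul, ih.1, ih.2,
      f3, f4, zpow_sub_one]
    push_cast
    simp
    ring

/-- Jacobi's identity for the cube of Euler's product, modulo `y ^ N`. -/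
theorem pow_dvd_prod_cube_sub_sum (y : S) {e : ℤ → ℕ}
    (he : ∀ k : ℤ, 2 * (e k : ℤ) = k ^ 2 + k) (N : ℕ) :
    y ^ N ∣ (∏ i ∈ Finset.range N, (1 - y ^ (i + 1))) ^ 3 -
      ∑ k ∈ Finset.Icc (-N : ℤ) N, ((((-1 : ℤˣ) ^ k : ℤˣ) : ℤ) : S) * k * y ^ e k := by
  cases N with
  | zero => simp
  | succ n =>
    -- This differentiates the triple product at z = -1: for z = -(1 + ε) and b = 0 the factor 1 +
    -- z⁻¹ equals ε, and z^k = (-1)^k (1 + kε), so comparing ε-parts gives the cube.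
    have h := pow_dvd_tripleProduct_sub_sum (TrivSqZeroExt.inl y : DualNumber S) (dualUnit S)
      (a := 1) (b := 0) (e := e) (by norm_num) (by simpa using he) (n + 1)
    set E : DualNumber S := TrivSqZeroExt.inr 1 with hE
    have f0 : 1 + (((dualUnit S)⁻¹ : (DualNumber S)ˣ) : DualNumber S) = E := by
      ext
      · simp [dualUnit, hE]
      · simp [dualUnit, hE]
    have hfac : ∏ i ∈ Finset.range (n + 1),
        ((1 + ((dualUnit S : (DualNumber S)ˣ) : DualNumber S) *
            TrivSqZeroExt.inl y ^ (1 + (1 + 0) * i)) *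
          (1 + (((dualUnit S)⁻¹ : (DualNumber S)ˣ) : DualNumber S) *
            TrivSqZeroExt.inl y ^ (0 + (1 + 0) * i)) *
          (1 - TrivSqZeroExt.inl y ^ ((1 + 0) * (i + 1)))) =
        E * ((∏ i ∈ Finset.range (n + 1), (1 + ((dualUnit S : (DualNumber S)ˣ) : DualNumber S) *
            TrivSqZeroExt.inl y ^ (i + 1))) *
          (∏ i ∈ Finset.range n, (1 + (((dualUnit S)⁻¹ : (DualNumber S)ˣ) : DualNumber S) *
            TrivSqZeroExt.inl y ^ (i + 1))) *
          ∏ i ∈ Finset.range (n + 1), (1 - TrivSqZeroExt.inl y ^ (i + 1))) := by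
      rw [Finset.prod_mul_distrib, Finset.prod_mul_distrib,
        Finset.prod_range_succ' (fun i => 1 + (((dualUnit S)⁻¹ : (DualNumber S)ˣ) : DualNumber S) *
            TrivSqZeroExt.inl y ^ (0 + (1 + 0) * i)) n]
      simp only [add_zero, one_mul, zero_add, pow_zero, mul_one, f0]
      simp only [add_comm 1]
      ring
    obtain ⟨w, hw⟩ := h
    rw [hfac, TrivSqZeroExt.inl_pow y (n + 1)] at hw
    have hw' := congrArg TrivSqZeroExt.snd hw
    have g1 : ∀ t : DualNumber S, TrivSqZeroExt.snd (E * t) = TrivSqZeroExt.fst t := by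
      intro t
      simp [hE, TrivSqZeroExt.snd_mul]
    have g2 : ∀ (p : ℕ) (u : DualNumber S), TrivSqZeroExt.fst (1 + u * TrivSqZeroExt.inl y ^ p) =
        1 + TrivSqZeroExt.fst u * y ^ p := by
      intro p u
      simp
    have f1 : TrivSqZeroExt.fst ((dualUnit S : (DualNumber S)ˣ) : DualNumber S) = -1 := by simp [dualUnit]
    have f3 : TrivSqZeroExt.fst (((dualUnit S)⁻¹ : (DualNumber S)ˣ) : DualNumber S) = -1 := by simp [dualUnit]
    have g3 : ∀ (m : ℕ) (F : ℕ → DualNumber S), TrivSqZeroExt.fst (∏ i ∈ Finset.range m, F i) =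
        ∏ i ∈ Finset.range m, TrivSqZeroExt.fst (F i) := fun m F =>
      map_prod (TrivSqZeroExt.fstHom S S S) F (Finset.range m)
    rw [TrivSqZeroExt.snd_sub, g1, TrivSqZeroExt.fst_mul, TrivSqZeroExt.fst_mul, g3, g3, g3,
      TrivSqZeroExt.snd_sum] at hw'
    have g4 : ∀ k : ℤ, TrivSqZeroExt.snd (((dualUnit S ^ k : (DualNumber S)ˣ) : DualNumber S) *
        TrivSqZeroExt.inl y ^ e k) = ((((-1 : ℤˣ) ^ k : ℤˣ) : ℤ) : S) * k * y ^ e k := by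
      intro k
      rw [TrivSqZeroExt.inl_pow, TrivSqZeroExt.snd_mul, (fst_snd_dualUnit_zpow k).2]
      simp
    have g5 : TrivSqZeroExt.snd ((TrivSqZeroExt.inl (y ^ (n + 1)) : DualNumber S) * w) =
        y ^ (n + 1) * TrivSqZeroExt.snd w := by
      simp [TrivSqZeroExt.snd_mul]
    rw [g5] at hw'
    simp only [g2, g4, f1, f3, TrivSqZeroExt.fst_sub, TrivSqZeroExt.fst_one,
      TrivSqZeroExt.fst_pow, TrivSqZeroExt.fst_inl, neg_one_mul, ← sub_eq_add_neg] at hw'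
    -- Splitting off ε leaves one of the three products a factor short; restoring 1 - y^(n+1)
    -- changes the result by a multiple of y^(n+1).
    refine ⟨TrivSqZeroExt.snd w - (∏ i ∈ Finset.range (n + 1), (1 - y ^ (i + 1))) ^ 2 *
      ∏ i ∈ Finset.range n, (1 - y ^ (i + 1)), ?_⟩
    have g6 := Finset.prod_range_succ (fun i => 1 - y ^ (i + 1)) n
    linear_combination hw' + (∏ i ∈ Finset.range (n + 1), (1 - y ^ (i + 1))) ^ 2 * g6

end JacobiCube

/-! ### Identities between theta series. -/

section ThetaIdentities

open PowerSeries
open scoped PowerSeries.WithPiTopology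

/-- The quadratic exponent `a * k ^ 2 + b * k + c`. -/
def quadExp (a b c k : ℤ) : ℕ := (a * k ^ 2 + b * k + c).toNat

/-- The left side is the extremal case b·k = -(a + c)|k|. It shows that `quadExp` never truncates
and has finite fibres. -/
theorem le_quadratic {a b c : ℤ} (hc : 0 ≤ c) (hca : c ≤ a) (hb : |b| ≤ a + c) (k : ℤ) :
    (|k| - 1) * (a * |k| - c) ≤ a * k ^ 2 + b * k + c := by
  have h1 : -(a + c) * |k| ≤ b * k := by
    have h2 := neg_abs_le (b * k)
    rw [abs_mul] at h2
    nlinarith [abs_nonneg k]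
  nlinarith [sq_abs k]

theorem natCast_quadExp {a b c : ℤ} (hc : 0 ≤ c) (hca : c ≤ a) (hb : |b| ≤ a + c) (k : ℤ) :
    (quadExp a b c k : ℤ) = a * k ^ 2 + b * k + c := by
  refine Int.toNat_of_nonneg ?_
  rcases eq_or_ne k 0 with rfl | hk
  · simpa using hc
  have h1 : 1 ≤ |k| := Int.one_le_abs hk
  refine le_trans ?_ (le_quadratic hc hca hb k)
  exact mul_nonneg (by omega) (by nlinarith)

theorem finiteBelow_quadExp {a b c : ℤ} (hc : 0 ≤ c) (hca : c < a) (hb : |b| ≤ a + c) :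
    FiniteBelow (quadExp a b c) := fun n =>
  (Set.finite_Icc (-(n + 1) : ℤ) (n + 1)).subset fun k hk => by
    have hk' : (quadExp a b c k : ℤ) ≤ n := by exact_mod_cast hk
    rw [natCast_quadExp hc hca.le hb] at hk'
    have h1 := le_quadratic hc hca.le hb k
    rw [Set.mem_Icc, ← abs_le]
    by_contra! h
    have h2 : 1 ≤ a * |k| - c := by nlinarith
    nlinarith

theorem units_neg_one_zpow_eq {a b : ℤ} (h : Even (a - b)) :
    (((-1 : ℤˣ) ^ a : ℤˣ) : ℤ) = (((-1 : ℤˣ) ^ b : ℤˣ) : ℤ) :=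
  congrArg Units.val (Int.negOnePow_eq_iff a b |>.2 h)

theorem units_neg_one_zpow_even {a : ℤ} (h : Even a) : (((-1 : ℤˣ) ^ a : ℤˣ) : ℤ) = 1 :=
  congrArg Units.val (Int.negOnePow_even a h)

theorem units_neg_one_zpow_odd {a : ℤ} (h : Odd a) : (((-1 : ℤˣ) ^ a : ℤˣ) : ℤ) = -1 :=
  congrArg Units.val (Int.negOnePow_odd a h)

/-- Jacobi's identity for the cube of Euler's product, at `s * X ^ m` for a sign `s`. -/
theorem tprod_cube (s : ℤˣ) {m : ℕ} (hm : 0 < m) :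
    (∏' i : ℕ, (1 - (C (s : ℤ) * X ^ m : ℤ⟦X⟧) ^ (i + 1))) ^ 3 =
      exponentSeries (fun j => m * quadExp 2 1 0 j)
        fun j => (s : ℤ) ^ quadExp 2 1 0 j * (4 * j + 1) := by
  set y : ℤ⟦X⟧ := C (s : ℤ) * X ^ m with hy
  have hXy : ∀ N, (X : ℤ⟦X⟧) ^ N ∣ y ^ N := fun N =>
    pow_dvd_pow_of_dvd ((dvd_pow_self _ hm.ne').trans (dvd_mul_left _ _)) N
  have hmul : Multipliable fun i : ℕ => (1 - y ^ (i + 1)) := by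
    simp only [sub_eq_add_neg]
    exact multipliable_one_add_of_dvd fun i =>
      (dvd_neg.2 ((pow_dvd_pow _ (Nat.le_succ i)).trans (hXy (i + 1))))
  set T : ℤ → ℕ := fun k => (k * (k + 1) / 2).toNat with hT
  have hT2 : ∀ k : ℤ, 2 * (T k : ℤ) = k ^ 2 + k := by
    intro k
    obtain ⟨t, ht⟩ := even_iff_two_dvd.1 (Int.even_mul_succ_self k)
    have h0 : 0 ≤ k * (k + 1) := by
      rcases le_or_gt 0 k with h | h
      · exact mul_nonneg h (by omega)
      · exact mul_nonneg_of_nonpos_of_nonpos h.le (by omega)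
    have h1 : ((k * (k + 1) / 2).toNat : ℤ) = k * (k + 1) / 2 := Int.toNat_of_nonneg (by omega)
    rw [hT]
    simp only [h1]
    have h2 : k * (k + 1) = k ^ 2 + k := by ring
    omega
  have hTk : ∀ k, |k| ≤ T k + 1 := fun k =>
    abs_le_of_two_mul_eq (a := 1) (b := 0) (by norm_num) (by simpa using hT2) k
  have h1 : (∏' i : ℕ, (1 - y ^ (i + 1))) ^ 3 = exponentSeries (fun k => m * T k)
      fun k => (((-1 : ℤˣ) ^ k : ℤˣ) : ℤ) * k * (s : ℤ) ^ T k := by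
    rw [pow_succ, pow_two, ← hmul.tprod_mul hmul, ← (hmul.mul hmul).tprod_mul hmul]
    refine tprod_eq_of_pow_dvd ((hmul.mul hmul).mul hmul) fun N => ?_
    have h2 := (hXy N).trans (pow_dvd_prod_cube_sub_sum y hT2 N)
    have h3 := pow_dvd_exponentSeries_sub (e := fun k => m * T k)
      (fun k => (((-1 : ℤˣ) ^ k : ℤˣ) : ℤ) * k * (s : ℤ) ^ T k) (N := N)
      (s := Finset.Icc (-N : ℤ) N) (by
        intro k hk
        have h4 := abs_le.1 (hTk k)
        have h5 : T k ≤ m * T k := Nat.le_mul_of_pos_left _ hm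
        rw [Finset.mem_Icc]
        omega)
    have h4 : ∑ k ∈ Finset.Icc (-N : ℤ) N,
        ((((-1 : ℤˣ) ^ k : ℤˣ) : ℤ) : ℤ⟦X⟧) * k * y ^ T k =
        ∑ k ∈ Finset.Icc (-N : ℤ) N,
          C ((((-1 : ℤˣ) ^ k : ℤˣ) : ℤ) * k * (s : ℤ) ^ T k) * X ^ (m * T k) := by
      refine Finset.sum_congr rfl fun k _ => ?_
      rw [hy, mul_pow, map_mul, map_mul, map_pow, pow_mul, eq_intCast (C (R := ℤ)) k,
        eq_intCast (C (R := ℤ)) (((-1 : ℤˣ) ^ k : ℤˣ) : ℤ), mul_assoc, mul_assoc, mul_assoc]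
    rw [h4] at h2
    have h5 := dvd_sub h2 h3
    rw [sub_sub_sub_cancel_right] at h5
    convert h5 using 2
    rw [← Finset.prod_pow]
    refine Finset.prod_congr rfl fun i _ => ?_
    ring
  rw [h1]
  -- The indices 2j and -2j - 1 have the same triangular number; their coefficients 2j and 2j + 1
  -- add up to 4j + 1.
  set σ : ℤ ⊕ ℤ → ℤ := Sum.elim (fun j => 2 * j) (fun j => -2 * j - 1) with hσ
  have hbij : Function.Bijective σ := by
    constructor
    · rintro (i | i) (j | j) h <;> simp only [hσ, Sum.elim_inl, Sum.elim_inr] at h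
      · congr 1; omega
      · omega
      · omega
      · congr 1; omega
    · intro k
      rcases Int.even_or_odd' k with ⟨j, rfl | rfl⟩
      · exact ⟨Sum.inl j, rfl⟩
      · exact ⟨Sum.inr (-j - 1), by simp only [hσ, Sum.elim_inr]; ring⟩
  have hq : ∀ j, (quadExp 2 1 0 j : ℤ) = 2 * j ^ 2 + j := fun j => by
    rw [natCast_quadExp (by norm_num) (by norm_num) (by norm_num)]
    ring
  have hTl : ∀ j, T (2 * j) = quadExp 2 1 0 j := fun j => by
    have h2 := hT2 (2 * j)
    have h3 := hq j
    zify
    linarith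
  have hTr : ∀ j, T (-2 * j - 1) = quadExp 2 1 0 j := fun j => by
    have h2 := hT2 (-2 * j - 1)
    have h3 := hq j
    zify
    linarith
  rw [← exponentSeries_comp_bijective hbij]
  have hfin : FiniteBelow fun j => m * quadExp 2 1 0 j := fun n =>
    (finiteBelow_quadExp (a := 2) (b := 1) (c := 0) (by norm_num) (by norm_num) (by norm_num)
      n).subset fun k hk => by
        have : quadExp 2 1 0 k ≤ m * quadExp 2 1 0 k := Nat.le_mul_of_pos_left _ hm
        exact this.trans hk
  have he : (fun i => m * T (σ i)) =
      Sum.elim (fun j => m * quadExp 2 1 0 j) (fun j => m * quadExp 2 1 0 j) := by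
    funext i
    rcases i with j | j
    · simp only [hσ, Sum.elim_inl, hTl]
    · simp only [hσ, Sum.elim_inr, hTr]
  have hc : (fun i => (((-1 : ℤˣ) ^ σ i : ℤˣ) : ℤ) * σ i * (s : ℤ) ^ T (σ i)) =
      Sum.elim (fun j => 2 * j * (s : ℤ) ^ quadExp 2 1 0 j)
        (fun j => (2 * j + 1) * (s : ℤ) ^ quadExp 2 1 0 j) := by
    funext i
    rcases i with j | j
    · simp only [hσ, Sum.elim_inl, hTl]
      rw [units_neg_one_zpow_even (even_two_mul j), one_mul]
    · simp only [hσ, Sum.elim_inr, hTr]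
      rw [units_neg_one_zpow_odd ⟨-j - 1, by ring⟩]
      ring
  rw [he, hc, exponentSeries_sumElim hfin hfin, exponentSeries_add hfin]
  congr 1
  funext j
  ring

/-- A quintuple product identity: the product of two theta series splits off Euler's product. -/
theorem theta_mul_theta_eq {α β : ℤ} (hα : 1 ≤ α) (hβ : 1 ≤ β) (hαβ : α + β = 4) :
    exponentSeries (quadExp 4 (-α) 0) (fun k => (((-1 : ℤˣ) ^ k : ℤˣ) : ℤ)) *
        exponentSeries (quadExp 8 (-2 * β) 0) (fun k => (((-1 : ℤˣ) ^ k : ℤˣ) : ℤ)) =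
      exponentSeries (quadExp 24 8 0) (fun k => (((-1 : ℤˣ) ^ k : ℤˣ) : ℤ)) *
        exponentSeries (Sum.elim (quadExp 12 (2 * β - α) 0)
          (quadExp 12 (16 + α - 2 * β) (8 - 2 * β))) (Sum.elim (fun _ => 1) fun _ => -1) := by
  have b1 : |(-α)| ≤ 4 + 0 := abs_le.2 (by omega)
  have b2 : |(-2 * β)| ≤ 8 + 0 := abs_le.2 (by omega)
  have b3 : |(8 : ℤ)| ≤ 24 + 0 := by norm_num
  have b4 : |2 * β - α| ≤ 12 + 0 := abs_le.2 (by omega)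
  have b5 : |16 + α - 2 * β| ≤ 12 + (8 - 2 * β) := abs_le.2 (by omega)
  have q1 := natCast_quadExp le_rfl (by norm_num) b1
  have q2 := natCast_quadExp le_rfl (by norm_num) b2
  have q3 := natCast_quadExp le_rfl (by norm_num) b3
  have q4 := natCast_quadExp le_rfl (by norm_num) b4
  have q5 := natCast_quadExp (a := 12) (by omega) (by omega) b5
  have f1 := finiteBelow_quadExp le_rfl (by norm_num) b1
  have f2 := finiteBelow_quadExp le_rfl (by norm_num) b2
  have f3 := finiteBelow_quadExp le_rfl (by norm_num) b3
  have f4 := finiteBelow_quadExp le_rfl (by norm_num) b4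
  have f5 := finiteBelow_quadExp (a := 12) (by omega) (by omega) b5
  rw [exponentSeries_mul f1 f2, exponentSeries_sumElim f4 f5, mul_add, exponentSeries_mul f3 f4,
    exponentSeries_mul f3 f5]
  -- The pairs (k, l) are split by k + l mod 3. On classes 0 and 1 the quadratic form becomes
  -- diagonal, with 24m² + 8m as one summand.
  set σ : (ℤ × ℤ) ⊕ ((ℤ × ℤ) ⊕ (ℤ × ℤ)) → ℤ × ℤ :=
    Sum.elim (fun p => (p.2 - 2 * p.1, -p.1 - p.2))
      (Sum.elim (fun p => (2 * p.1 - p.2, p.2 + p.1 + 1))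
        (fun p => (2 * p.1 + 2 + p.2, p.1 - p.2))) with hσ
  have hbij : Function.Bijective σ := by
    constructor
    · rintro (⟨m, n⟩ | ⟨m, n⟩ | ⟨m, n⟩) (⟨m', n'⟩ | ⟨m', n'⟩ | ⟨m', n'⟩) h <;>
        simp only [hσ, Sum.elim_inl, Sum.elim_inr, Prod.mk.injEq] at h <;>
        simp only [Sum.inl.injEq, Sum.inr.injEq, Prod.mk.injEq, reduceCtorEq] <;> omega
    · rintro ⟨k, l⟩
      have h3 : (k + l) % 3 = 0 ∨ (k + l) % 3 = 1 ∨ (k + l) % 3 = 2 := by omega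
      rcases h3 with h | h | h
      · exact ⟨Sum.inl (-((k + l) / 3), (k + l) / 3 - l), by
          simp only [hσ, Sum.elim_inl, Prod.mk.injEq]; omega⟩
      · exact ⟨Sum.inr (Sum.inl ((k + l) / 3, l - (k + l) / 3 - 1)), by
          simp only [hσ, Sum.elim_inl, Sum.elim_inr, Prod.mk.injEq]; omega⟩
      · exact ⟨Sum.inr (Sum.inr ((k + l) / 3, (k + l) / 3 - l)), by
          simp only [hσ, Sum.elim_inr, Prod.mk.injEq]; omega⟩
  have hfinite := f1.add f2
  set e3 : ℤ × ℤ → ℕ := fun p => quadExp 4 (-α) 0 (2 * p.1 + 2 + p.2) +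
    quadExp 8 (-2 * β) 0 (p.1 - p.2) with he3
  set c3 : ℤ × ℤ → ℤ := fun p => (((-1 : ℤˣ) ^ (2 * p.1 + 2 + p.2) : ℤˣ) : ℤ) *
    (((-1 : ℤˣ) ^ (p.1 - p.2) : ℤˣ) : ℤ) with hc3
  have hf3 : FiniteBelow e3 := fun n => by
    refine Set.Finite.of_injOn (f := fun p : ℤ × ℤ => (2 * p.1 + 2 + p.2, p.1 - p.2)) ?_ ?_
      (hfinite n)
    · intro p hp
      exact hp
    · rintro ⟨m, n⟩ _ ⟨m', n'⟩ _ h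
      simp only [Prod.mk.injEq] at h ⊢
      omega
  -- On class 2 the reflection m ↦ -1 - m keeps the exponent, because α + β = 4, and reverses the
  -- sign (-1)^(3m+2).
  have hz : exponentSeries e3 c3 = 0 := by
    refine exponentSeries_eq_zero_of_involution
      ((Equiv.subLeft (-1 : ℤ)).prodCongr (Equiv.refl ℤ)) ?_ ?_
    · rintro ⟨m, n⟩
      simp only [he3, Equiv.prodCongr_apply, Prod.map_apply, Equiv.subLeft_apply,
        Equiv.refl_apply]
      zify
      rw [q1, q1, q2, q2]
      obtain rfl : β = 4 - α := by omega
      ring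
    · rintro ⟨m, n⟩
      simp only [hc3, Equiv.prodCongr_apply, Prod.map_apply, Equiv.subLeft_apply,
        Equiv.refl_apply]
      rw [← Units.val_mul, ← Units.val_mul, ← zpow_add, ← zpow_add]
      rcases Int.even_or_odd' m with ⟨t, rfl | rfl⟩
      · rw [units_neg_one_zpow_odd ⟨-3 * t - 1, by ring⟩, units_neg_one_zpow_even ⟨3 * t + 1, by ring⟩]
      · rw [units_neg_one_zpow_even ⟨-3 * t - 2, by ring⟩, units_neg_one_zpow_odd ⟨3 * t + 2, by ring⟩]
        rfl
  rw [← exponentSeries_comp_bijective hbij]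
  have he : (fun i => quadExp 4 (-α) 0 (σ i).1 + quadExp 8 (-2 * β) 0 (σ i).2) =
      Sum.elim (fun p : ℤ × ℤ => quadExp 24 8 0 p.1 + quadExp 12 (2 * β - α) 0 p.2)
        (Sum.elim (fun p : ℤ × ℤ => quadExp 24 8 0 p.1 +
          quadExp 12 (16 + α - 2 * β) (8 - 2 * β) p.2) e3) := by
    obtain rfl : β = 4 - α := by omega
    funext i
    rcases i with ⟨m, n⟩ | ⟨m, n⟩ | ⟨m, n⟩
    · simp only [hσ, Sum.elim_inl]
      zify
      rw [q1, q2, q3, q4]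
      ring
    · simp only [hσ, Sum.elim_inl, Sum.elim_inr]
      zify
      rw [q1, q2, q3, q5]
      ring
    · rfl
  have hc : (fun i => (((-1 : ℤˣ) ^ (σ i).1 : ℤˣ) : ℤ) * (((-1 : ℤˣ) ^ (σ i).2 : ℤˣ) : ℤ)) =
      Sum.elim (fun p : ℤ × ℤ => (((-1 : ℤˣ) ^ p.1 : ℤˣ) : ℤ) * 1)
        (Sum.elim (fun p : ℤ × ℤ => (((-1 : ℤˣ) ^ p.1 : ℤˣ) : ℤ) * -1) c3) := by
    funext i
    rcases i with ⟨m, n⟩ | ⟨m, n⟩ | ⟨m, n⟩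
    · simp only [hσ, Sum.elim_inl]
      rw [← Units.val_mul, ← zpow_add, mul_one]
      exact units_neg_one_zpow_eq ⟨-2 * m, by ring⟩
    · simp only [hσ, Sum.elim_inl, Sum.elim_inr]
      rw [← units_neg_one_zpow_odd odd_one, ← Units.val_mul, ← Units.val_mul, ← zpow_add,
        ← zpow_add]
      exact units_neg_one_zpow_eq ⟨m, by ring⟩
    · rfl
  rw [he, hc, exponentSeries_sumElim (f3.add f4) ((f3.add f5).sumElim hf3),
    exponentSeries_sumElim (f3.add f5) hf3, hz, add_zero]

/-- For indices l and k of the two series put i = l - k and s = l + k. The coefficient factors as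
(4i + 1)(1 - 2s) and the exponent is (2i² + i) + (2s² - 2s). Since s has the parity of i, setting s
= -2j or s = 2j + 1 turns these into ±(4i + 1)(4j + 1) and (2i² + i) + 4(2j² + j), with the sign
(-1)^i. -/
theorem wronskian_theta_eq :
    wronskianSeries (exponentSeries (quadExp 4 (-1) 0) fun _ => 1)
        (exponentSeries (quadExp 4 (-3) 0) fun _ => 1) =
      exponentSeries (fun j => 1 * quadExp 2 1 0 j)
          (fun j => ((-1 : ℤˣ) : ℤ) ^ quadExp 2 1 0 j * (4 * j + 1)) *
        exponentSeries (fun j => 4 * quadExp 2 1 0 j)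
          (fun j => ((1 : ℤˣ) : ℤ) ^ quadExp 2 1 0 j * (4 * j + 1)) := by
  have b1 : |(-1 : ℤ)| ≤ 4 + 0 := by norm_num
  have b2 : |(-3 : ℤ)| ≤ 4 + 0 := by norm_num
  have b3 : |(1 : ℤ)| ≤ 2 + 0 := by norm_num
  have q1 := natCast_quadExp le_rfl (by norm_num) b1
  have q2 := natCast_quadExp le_rfl (by norm_num) b2
  have q3 := natCast_quadExp le_rfl (by norm_num) b3
  have f3 := finiteBelow_quadExp le_rfl (by norm_num) b3
  have f4 : ∀ m : ℕ, 0 < m → FiniteBelow fun j => m * quadExp 2 1 0 j := fun m hm n =>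
    (f3 n).subset fun k hk => (Nat.le_mul_of_pos_left _ hm).trans hk
  rw [wronskianSeries_exponentSeries (finiteBelow_quadExp le_rfl (by norm_num) b1)
    (finiteBelow_quadExp le_rfl (by norm_num) b2),
    exponentSeries_mul (f4 1 one_pos) (f4 4 (by norm_num))]
  set σ : ℤ × ℤ → ℤ × ℤ := fun p => if p.1 % 2 = 0 then ((-2 * p.2 + p.1) / 2, (-2 * p.2 - p.1) / 2)
    else ((2 * p.2 + 1 + p.1) / 2, (2 * p.2 + 1 - p.1) / 2) with hσ
  have hbij : Function.Bijective σ := by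
    constructor
    · rintro ⟨i, j⟩ ⟨i', j'⟩ h
      simp only [hσ] at h
      split_ifs at h <;> simp only [Prod.mk.injEq] at h ⊢ <;> omega
    · rintro ⟨l, k⟩
      rcases Int.emod_two_eq_zero_or_one (k + l) with h | h
      · refine ⟨(l - k, -((k + l) / 2)), ?_⟩
        simp only [hσ]
        rw [if_pos (by omega), Prod.mk.injEq]
        omega
      · refine ⟨(l - k, (k + l) / 2), ?_⟩
        simp only [hσ]
        rw [if_neg (by omega), Prod.mk.injEq]
        omega
  rw [← exponentSeries_comp_bijective hbij]
  have hev : ∀ i j, σ (2 * i, j) = (i - j, -j - i) := fun i j => by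
    simp only [hσ]
    rw [if_pos (by omega), Prod.mk.injEq]
    omega
  have hod : ∀ i j, σ (2 * i + 1, j) = (j + i + 1, j - i) := fun i j => by
    simp only [hσ]
    rw [if_neg (by omega), Prod.mk.injEq]
    omega
  congr 1
  · funext ⟨i, j⟩
    zify
    rw [q1, q2, q3, q3]
    rcases Int.even_or_odd' i with ⟨t, rfl | rfl⟩
    · rw [hev]
      ring
    · rw [hod]
      ring
  · funext ⟨i, j⟩
    rw [q1, q2]
    rcases Int.even_or_odd' i with ⟨t, rfl | rfl⟩
    · have : Even (quadExp 2 1 0 (2 * t)) := by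
        rw [← Int.even_coe_nat, q3]
        exact ⟨4 * t ^ 2 + t, by ring⟩
      rw [hev, Units.val_neg, Units.val_one, this.neg_one_pow]
      ring
    · have : Odd (quadExp 2 1 0 (2 * t + 1)) := by
        rw [← Int.odd_coe_nat, q3]
        exact ⟨4 * t ^ 2 + 5 * t + 1, by ring⟩
      rw [hod, Units.val_neg, Units.val_one, this.neg_one_pow]
      ring

end ThetaIdentities

/-! ### The eta quotient f_2^7/f_1. -/

section EtaQuotient

open PowerSeries
open scoped PowerSeries.WithPiTopology

/-- Euler's product `f_k = ∏_{i ≥ 1} (1 - X ^ (k * i))`. -/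
noncomputable def eulerProd (k : ℕ) : ℤ⟦X⟧ := progProd (-1) k k

/-- The theta series of a union of two arithmetic progressions, with opposite signs. -/
noncomputable def quintupleTheta (b b' c : ℤ) : ℤ⟦X⟧ :=
  exponentSeries (Sum.elim (quadExp 12 b 0) (quadExp 12 b' c)) (Sum.elim (fun _ => 1) fun _ => -1)

theorem eulerProd_eq_tprod_pow (m : ℕ) :
    eulerProd m = ∏' i : ℕ, (1 - (C ((1 : ℤˣ) : ℤ) * X ^ m : ℤ⟦X⟧) ^ (i + 1)) := by
  refine tprod_congr fun i => ?_
  simp only [Units.val_neg, Units.val_one, map_neg, map_one, one_mul, neg_one_mul]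
  rw [← pow_mul, ← sub_eq_add_neg, mul_add, mul_one, add_comm]

/-- This is f_1 at -X: only the factors with odd exponent change sign. -/
theorem progProd_mul_eulerProd_two_eq_tprod :
    progProd 1 1 2 * eulerProd 2 =
      ∏' i : ℕ, (1 - (C ((-1 : ℤˣ) : ℤ) * X ^ 1 : ℤ⟦X⟧) ^ (i + 1)) := by
  have h1 : ∀ i : ℕ, (1 + C ((1 : ℤˣ) : ℤ) * X ^ (1 + 2 * i) : ℤ⟦X⟧) =
      1 - (C ((-1 : ℤˣ) : ℤ) * X ^ 1 : ℤ⟦X⟧) ^ (2 * i + 1) := fun i => by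
    have : Odd (2 * i + 1) := ⟨i, rfl⟩
    rw [Units.val_neg, Units.val_one, map_neg, map_one, neg_one_mul, pow_one, this.neg_pow]
    ring
  have h2 : ∀ i : ℕ, (1 + C ((-1 : ℤˣ) : ℤ) * X ^ (2 + 2 * i) : ℤ⟦X⟧) =
      1 - (C ((-1 : ℤˣ) : ℤ) * X ^ 1 : ℤ⟦X⟧) ^ (2 * i + 1 + 1) := fun i => by
    have : Even (2 * i + 1 + 1) := ⟨i + 1, by ring⟩
    rw [Units.val_neg, Units.val_one, map_neg, map_one, neg_one_mul, neg_one_mul, pow_one,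
      this.neg_pow]
    ring
  have m1 := multipliable_progProd 1 1 two_pos
  have m2 := multipliable_progProd (-1) 2 two_pos
  rw [progProd, eulerProd, progProd]
  simp only [h1, h2] at m1 m2 ⊢
  exact tprod_even_mul_odd (f := fun i => 1 - (C ((-1 : ℤˣ) : ℤ) * X ^ 1 : ℤ⟦X⟧) ^ (i + 1)) m1 m2

theorem eulerProd_ne_zero {k : ℕ} (hk : 0 < k) : eulerProd k ≠ 0 := progProd_ne_zero _ hk hk

theorem progProd_one_two_mul_eulerProd : progProd (-1) 1 2 * eulerProd 2 = eulerProd 1 := by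
  have h := progProd_mul_progProd_two (-1) 1 one_pos
  simp only [Nat.reduceMul, Nat.reduceAdd] at h
  rw [eulerProd, eulerProd, h]

theorem prod_progProd_eight :
    progProd (-1) 1 8 * progProd (-1) 3 8 * progProd (-1) 5 8 * progProd (-1) 7 8 =
      progProd (-1) 1 2 := by
  rw [← progProd_mul_progProd_two (-1) 1 (show 0 < 2 by norm_num),
    ← progProd_mul_progProd_two (-1) 1 (show 0 < 2 * 2 by norm_num),
    ← progProd_mul_progProd_two (-1) (1 + 2) (show 0 < 2 * 2 by norm_num)]
  norm_num
  ring

theorem theta_eq_progProd {a b M : ℕ} (hab : a + b = M) (hM : 0 < M) (s : ℤˣ) {A B : ℤ}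
    (hA : 2 * A = M) (hB : 2 * B = a - b) :
    exponentSeries (quadExp A B 0) (fun k => ((s ^ k : ℤˣ) : ℤ)) =
      progProd s a M * progProd s b M * eulerProd M := by
  refine (tripleProduct s hab hM fun k => ?_).symm
  have hB' : |B| ≤ A + 0 := abs_le.2 (by omega)
  rw [natCast_quadExp le_rfl (by omega) hB']
  have h1 : (a + b : ℤ) = 2 * A := by rw [hA]; exact_mod_cast hab
  rw [h1, ← hB]
  ring

/-- Euler's pentagonal number theorem in X^16, as 24k² + 8k = 16·k(3k + 1)/2; the progressions 16,
32, 48 mod 48 together make up the multiples of 16. -/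
theorem eulerProd_sixteen_eq_exponentSeries :
    exponentSeries (quadExp 24 8 0) (fun k => (((-1 : ℤˣ) ^ k : ℤˣ) : ℤ)) = eulerProd 16 := by
  rw [theta_eq_progProd (a := 32) (b := 16) (M := 48) (by norm_num) (by norm_num) (-1)
    (by norm_num) (by norm_num), eulerProd, eulerProd,
    ← progProd_mul_progProd_three (-1) 16 (show 0 < 16 by norm_num)]
  simp only [Nat.reduceMul, Nat.reduceAdd]
  ring

/-- The factors 1 - X^(16i+6) and 1 - X^(16i+10) split as differences of squares. Their minus parts
join the classes 1, 7 mod 8 to give all odd exponents, that is f_1/f_2; their plus parts and f_8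
form the theta series on the right. The companion identity exchanges the classes {1, 7} and {3, 5}.
-/
theorem eulerProd_two_mul_quintupleTheta₁ :
    eulerProd 2 * quintupleTheta (-1) 17 6 =
      eulerProd 1 * exponentSeries (quadExp 4 (-1) 0) fun _ => 1 := by
  have h := theta_mul_theta_eq (α := 3) (β := 1) (by norm_num) (by norm_num) (by norm_num)
  norm_num at h
  rw [eulerProd_sixteen_eq_exponentSeries,
    theta_eq_progProd (a := 1) (b := 7) (M := 8) (by norm_num) (by norm_num) (-1)
      (by norm_num) (by norm_num),
    theta_eq_progProd (a := 6) (b := 10) (M := 16) (by norm_num) (by norm_num) (-1)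
      (by norm_num) (by norm_num),
    ← progProd_one_mul_progProd_neg_one 3 (show 0 < 8 by norm_num),
    ← progProd_one_mul_progProd_neg_one 5 (show 0 < 8 by norm_num)] at h
  have h' := theta_eq_progProd (a := 3) (b := 5) (M := 8) (by norm_num) (by norm_num) 1
      (A := 4) (B := -1) (by norm_num) (by norm_num)
  simp only [one_zpow, Units.val_one] at h'
  rw [h']
  refine mul_left_cancel₀ (eulerProd_ne_zero (show 0 < 16 by norm_num)) ?_
  rw [quintupleTheta]
  linear_combination (-eulerProd 2) * h + eulerProd 16 * progProd 1 3 8 * progProd 1 5 8 *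
    eulerProd 8 * (progProd_one_two_mul_eulerProd + eulerProd 2 * prod_progProd_eight)

theorem eulerProd_two_mul_quintupleTheta₂ :
    eulerProd 2 * quintupleTheta 5 11 2 =
      eulerProd 1 * exponentSeries (quadExp 4 (-3) 0) fun _ => 1 := by
  have h := theta_mul_theta_eq (α := 1) (β := 3) (by norm_num) (by norm_num) (by norm_num)
  norm_num at h
  rw [eulerProd_sixteen_eq_exponentSeries,
    theta_eq_progProd (a := 3) (b := 5) (M := 8) (by norm_num) (by norm_num) (-1)
      (by norm_num) (by norm_num),
    theta_eq_progProd (a := 2) (b := 14) (M := 16) (by norm_num) (by norm_num) (-1)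
      (by norm_num) (by norm_num),
    ← progProd_one_mul_progProd_neg_one 1 (show 0 < 8 by norm_num),
    ← progProd_one_mul_progProd_neg_one 7 (show 0 < 8 by norm_num)] at h
  have h' := theta_eq_progProd (a := 1) (b := 7) (M := 8) (by norm_num) (by norm_num) 1
      (A := 4) (B := -3) (by norm_num) (by norm_num)
  simp only [one_zpow, Units.val_one] at h'
  rw [h']
  refine mul_left_cancel₀ (eulerProd_ne_zero (show 0 < 16 by norm_num)) ?_
  rw [quintupleTheta]
  linear_combination (-eulerProd 2) * h + eulerProd 16 * progProd 1 1 8 * progProd 1 7 8 *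
    eulerProd 8 * (progProd_one_two_mul_eulerProd + eulerProd 2 * prod_progProd_eight)

/-- The eta quotient `f_2 ^ 7 / f_1` is a Wronskian of two theta series. -/
theorem eulerProd_one_mul_wronskianSeries :
    eulerProd 1 * wronskianSeries (quintupleTheta (-1) 17 6) (quintupleTheta 5 11 2) =
      eulerProd 2 ^ 7 := by
  have h1 := wronskianSeries_mul_mul (eulerProd 2) (quintupleTheta (-1) 17 6)
    (quintupleTheta 5 11 2)
  have hc4 := tprod_cube 1 (show 0 < 4 by norm_num)
  have hc1 := tprod_cube (-1) one_pos
  rw [← eulerProd_eq_tprod_pow] at hc4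
  rw [← progProd_mul_eulerProd_two_eq_tprod] at hc1
  rw [eulerProd_two_mul_quintupleTheta₁, eulerProd_two_mul_quintupleTheta₂,
    wronskianSeries_mul_mul, wronskian_theta_eq, ← hc1, ← hc4] at h1
  have h2 : progProd 1 1 2 * progProd (-1) 1 2 = progProd (-1) 2 4 := by
    simpa only [Nat.reduceMul] using progProd_one_mul_progProd_neg_one 1 two_pos
  have h3 : progProd (-1) 2 4 * eulerProd 4 = eulerProd 2 := by
    have h := progProd_mul_progProd_two (-1) 2 two_pos
    simp only [Nat.reduceMul, Nat.reduceAdd] at h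
    rw [eulerProd, eulerProd, h]
  have h4 : progProd 1 1 2 * eulerProd 2 * eulerProd 4 * eulerProd 1 = eulerProd 2 ^ 3 := by
    rw [← progProd_one_two_mul_eulerProd]
    linear_combination eulerProd 2 ^ 2 * eulerProd 4 * h2 + eulerProd 2 ^ 2 * h3
  -- After multiplication by f_2², both sides are the cube of f_2³.
  refine mul_left_cancel₀ (pow_ne_zero 2 (eulerProd_ne_zero two_pos)) ?_
  calc _ = (progProd 1 1 2 * eulerProd 2 * eulerProd 4 * eulerProd 1) ^ 3 := by
        linear_combination (-eulerProd 1) * h1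
    _ = _ := by rw [h4]; ring

end EtaQuotient

/-! ### The generating function of generalized cubic partitions. -/

section GeneratingFunction

open PowerSeries
open scoped PowerSeries.WithPiTopology

/-- The coloured parts of size at most `N`. -/
def colouredParts (c N : ℕ) : Finset (ℕ × ℕ) :=
  (Finset.range N).biUnion fun i => (Finset.range (numColours c (i + 1))).image fun j => (i + 1, j)

theorem mem_colouredParts {c N : ℕ} {x : ℕ × ℕ} :
    x ∈ colouredParts c N ↔ 0 < x.1 ∧ x.1 ≤ N ∧ x.2 < numColours c x.1 := by
  obtain ⟨k, j⟩ := x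
  simp only [colouredParts, Finset.mem_biUnion, Finset.mem_range, Finset.mem_image,
    Prod.mk.injEq]
  constructor
  · rintro ⟨i, hi, j', hj', rfl, rfl⟩
    exact ⟨by omega, by omega, hj'⟩
  · rintro ⟨h1, h2, h3⟩
    obtain ⟨i, rfl⟩ := Nat.exists_eq_succ_of_ne_zero h1.ne'
    exact ⟨i, by omega, j, h3, rfl, rfl⟩

theorem prod_colouredParts (c N : ℕ) :
    ∏ x ∈ colouredParts c N, (1 - X ^ x.1 : ℤ⟦X⟧) =
      ∏ i ∈ Finset.range N, (1 - X ^ (i + 1)) ^ numColours c (i + 1) := by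
  rw [colouredParts, Finset.prod_biUnion]
  · refine Finset.prod_congr rfl fun i _ => ?_
    rw [Finset.prod_image]
    · simp
    · intro a _ b _ h
      simpa using h
  · intro i _ j _ hij
    simp only [Function.onFun, Finset.disjoint_left, Finset.mem_image]
    rintro _ ⟨a, _, rfl⟩ ⟨b, _, h⟩
    exact hij (by simpa using (congrArg Prod.fst h).symm)

theorem GeneralizedCubicPartition.mem_colouredParts {c n N : ℕ} (hn : n ≤ N)
    (p : GeneralizedCubicPartition c n) {x : ℕ × ℕ} (hx : x ∈ p.parts) :
    x ∈ colouredParts c N := by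
  refine _root_.mem_colouredParts.2 ⟨p.size_pos x hx, ?_, p.colour_lt x hx⟩
  have := Multiset.single_le_sum (fun _ _ => Nat.zero_le _) x.1
    (Multiset.mem_map_of_mem Prod.fst hx)
  rw [p.sum_sizes] at this
  omega

/-- A partition is encoded by the total size that each coloured part contributes, not by its
multiplicity; this is the indexing that `coeff_prod` gives for a product of geometric series. -/
theorem generalizedCubicCount_eq_card {c n N : ℕ} (hn : n ≤ N) :
    generalizedCubicCount c n = (((colouredParts c N).finsuppAntidiag n).filter
      fun l => ∀ x ∈ colouredParts c N, x.1 ∣ l x).card := by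
  set S := colouredParts c N with hS
  have hpos : ∀ x ∈ S, 0 < x.1 := fun x hx => (mem_colouredParts.1 hx).1
  have hmem : ∀ p : GeneralizedCubicPartition c n, ∀ x, x.1 * p.parts.count x ≠ 0 → x ∈ S :=
    fun p x hx => p.mem_colouredParts hn
      (Multiset.count_ne_zero.1 (right_ne_zero_of_mul hx))
  set f : GeneralizedCubicPartition c n → (ℕ × ℕ →₀ ℕ) := fun p =>
    Finsupp.onFinset S (fun x => x.1 * p.parts.count x) (hmem p) with hf
  have hfmem : ∀ p, f p ∈ (S.finsuppAntidiag n).filter fun l => ∀ x ∈ S, x.1 ∣ l x := by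
    intro p
    rw [Finset.mem_filter, Finset.mem_finsuppAntidiag]
    refine ⟨⟨?_, Finsupp.support_onFinset_subset⟩, fun x _ => Dvd.intro _ rfl⟩
    calc S.sum (f p) = ∑ x ∈ S, p.parts.count x • x.1 :=
          Finset.sum_congr rfl fun x _ => by
            simp only [hf, Finsupp.onFinset_apply, smul_eq_mul, mul_comm]
      _ = ∑ x ∈ p.parts.toFinset, p.parts.count x • x.1 := by
          symm
          refine Finset.sum_subset
            (fun x hx => p.mem_colouredParts hn (Multiset.mem_toFinset.1 hx)) fun x _ hx => ?_
          rw [Multiset.mem_toFinset] at hx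
          rw [Multiset.count_eq_zero_of_notMem hx, zero_smul]
      _ = n := by rw [← Finset.sum_multiset_map_count, p.sum_sizes]
  have hbij : Function.Bijective (fun p => (⟨f p, hfmem p⟩ :
      {l // l ∈ (S.finsuppAntidiag n).filter fun l => ∀ x ∈ S, x.1 ∣ l x})) := by
    constructor
    · intro p q h
      have h1 : f p = f q := congrArg Subtype.val h
      refine GeneralizedCubicPartition.ext (Multiset.ext' fun x => ?_)
      have h2 : x.1 * p.parts.count x = x.1 * q.parts.count x := DFunLike.congr_fun h1 x
      by_cases hx : x ∈ S
      · exact Nat.eq_of_mul_eq_mul_left (hpos x hx) h2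
      · rw [Multiset.count_eq_zero_of_notMem fun h3 => hx (p.mem_colouredParts hn h3),
          Multiset.count_eq_zero_of_notMem fun h3 => hx (q.mem_colouredParts hn h3)]
    · rintro ⟨l, hl⟩
      rw [Finset.mem_filter, Finset.mem_finsuppAntidiag] at hl
      obtain ⟨⟨hsum, hsupp⟩, hdvd⟩ := hl
      have hparts : ∀ x ∈ ∑ y ∈ S, Multiset.replicate (l y / y.1) y, x ∈ S := by
        intro x hx
        obtain ⟨y, hy, hxy⟩ := Multiset.mem_sum.1 hx
        rwa [Multiset.eq_of_mem_replicate hxy]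
      refine ⟨⟨∑ y ∈ S, Multiset.replicate (l y / y.1) y,
        fun x hx => hpos x (hparts x hx),
        fun x hx => (mem_colouredParts.1 (hparts x hx)).2.2, ?_⟩, ?_⟩
      · rw [← Multiset.coe_mapAddMonoidHom, map_sum, ← Multiset.coe_sumAddMonoidHom, map_sum,
          ← hsum]
        refine Finset.sum_congr rfl fun x hx => ?_
        simp [Nat.div_mul_cancel (hdvd x hx)]
      · refine Subtype.ext (Finsupp.ext fun x => ?_)
        simp only [hf, Finsupp.onFinset_apply, Multiset.count_sum', Multiset.count_replicate,
          Finset.sum_ite_eq']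
        split_ifs with hx
        · exact Nat.mul_div_cancel' (hdvd x hx)
        · rw [mul_zero]
          exact (Finsupp.notMem_support_iff.1 fun h => hx (hsupp h)).symm
  rw [generalizedCubicCount, Nat.card_congr (Equiv.ofBijective _ hbij), Nat.card_eq_fintype_card,
    Fintype.card_coe]

/-- The geometric series `1 / (1 - X ^ k)`. -/
noncomputable def geomSeries (k : ℕ) : ℤ⟦X⟧ := PowerSeries.mk fun n => if k ∣ n then 1 else 0

theorem geomSeries_mul_one_sub {k : ℕ} (hk : 0 < k) :
    geomSeries k * (1 - X ^ k) = 1 := by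
  ext n
  rw [mul_sub, mul_one, map_sub, coeff_mul_X_pow', geomSeries, coeff_mk, coeff_one]
  rcases Nat.lt_or_ge n k with h | h
  · rw [if_neg (show ¬ k ≤ n by omega), sub_zero]
    refine if_congr ⟨fun hd => ?_, fun h0 => h0 ▸ dvd_zero k⟩ rfl rfl
    by_contra h0
    exact absurd (Nat.le_of_dvd (Nat.pos_of_ne_zero h0) hd) (by omega)
  · rw [if_pos h, coeff_mk, if_neg (show ¬ n = 0 by omega), sub_eq_zero]
    exact if_congr ⟨fun hd => Nat.dvd_sub hd dvd_rfl, fun hd => by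
      simpa only [Nat.sub_add_cancel h] using hd.add dvd_rfl⟩ rfl rfl

theorem coeff_prod_geomSeries {c n N : ℕ} (hn : n ≤ N) :
    coeff n (∏ x ∈ colouredParts c N, geomSeries x.1) = generalizedCubicCount c n := by
  rw [coeff_prod, generalizedCubicCount_eq_card hn, Finset.card_filter]
  push_cast
  refine Finset.sum_congr rfl fun l _ => ?_
  simp only [geomSeries, coeff_mk, Finset.prod_ite_zero, Finset.prod_const_one]

/-- The generating function of the generalized cubic partitions. -/
noncomputable def cubicSeries (c : ℕ) : ℤ⟦X⟧ :=
  PowerSeries.mk fun n => (generalizedCubicCount c n : ℤ)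

theorem pow_dvd_cubicSeries_mul_prod_sub_one (c N : ℕ) :
    (X : ℤ⟦X⟧) ^ N ∣ cubicSeries c *
      ∏ i ∈ Finset.range N, (1 - X ^ (i + 1)) ^ numColours c (i + 1) - 1 := by
  have h1 : (∏ x ∈ colouredParts c N, geomSeries x.1) *
      ∏ x ∈ colouredParts c N, (1 - X ^ x.1 : ℤ⟦X⟧) = 1 := by
    rw [← Finset.prod_mul_distrib]
    exact Finset.prod_eq_one fun x hx => geomSeries_mul_one_sub (mem_colouredParts.1 hx).1
  rw [← prod_colouredParts]
  have h2 := sub_mul (cubicSeries c) (∏ x ∈ colouredParts c N, geomSeries x.1)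
    (∏ x ∈ colouredParts c N, (1 - X ^ x.1 : ℤ⟦X⟧))
  rw [h1] at h2
  rw [← h2]
  refine Dvd.dvd.mul_right (X_pow_dvd_iff.2 fun n hn => ?_) _
  rw [map_sub, coeff_prod_geomSeries hn.le, cubicSeries, coeff_mk, sub_self]

theorem cubicSeries_mul_eulerProd (c : ℕ) :
    cubicSeries (c + 1) * (eulerProd 1 * eulerProd 2 ^ c) = 1 := by
  have hF : ∀ i : ℕ, (1 - X ^ (i + 1) : ℤ⟦X⟧) ^ numColours (c + 1) (i + 1) =
      (1 - X ^ (i + 1)) * (if Even (i + 1) then (1 - X ^ (i + 1)) ^ c else 1) := by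
    intro i
    rw [numColours]
    split_ifs
    · rw [pow_succ, mul_comm]
    · rw [pow_one, mul_one]
  have e1 : ∀ i : ℕ, (1 + C ((-1 : ℤˣ) : ℤ) * X ^ (1 + 1 * i) : ℤ⟦X⟧) = 1 - X ^ (i + 1) := by
    intro i
    rw [Units.val_neg, Units.val_one, map_neg, map_one, neg_one_mul, ← sub_eq_add_neg, one_mul,
      add_comm]
  have e2 : ∀ i : ℕ, (1 + C ((-1 : ℤˣ) : ℤ) * X ^ (2 + 2 * i) : ℤ⟦X⟧) =
      1 - X ^ (2 * i + 1 + 1) := by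
    intro i
    rw [Units.val_neg, Units.val_one, map_neg, map_one, neg_one_mul, ← sub_eq_add_neg]
    ring_nf
  have p1 := (multipliable_progProd (-1) 1 one_pos).hasProd
  have p2 := (multipliable_progProd (-1) 2 two_pos).hasProd.pow c
  change HasProd _ (eulerProd 1) at p1
  change HasProd _ (eulerProd 2 ^ c) at p2
  simp only [e1] at p1
  simp only [e2] at p2
  have p3 : HasProd (fun i : ℕ => if Even (i + 1) then (1 - X ^ (i + 1) : ℤ⟦X⟧) ^ c else 1)
      (1 * eulerProd 2 ^ c) := by
    -- Index i stands for part size i + 1, so the even indices are the odd sizes and contribute 1.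
    refine HasProd.even_mul_odd ?_ ?_
    · convert hasProd_one using 2 with i
      rw [if_neg (Nat.not_even_iff_odd.2 ⟨i, rfl⟩)]
    · convert p2 using 2 with i
      rw [if_pos ⟨i + 1, by ring⟩]
  have p4 := p1.mul p3
  simp only [← hF, one_mul] at p4
  exact tendsto_nhds_unique (p4.tendsto_prod_nat.const_mul _)
    (tendsto_of_pow_dvd (pow_dvd_cubicSeries_mul_prod_sub_one (c + 1)))

end GeneratingFunction

/-! ### The congruences. -/

section Congruence

open PowerSeries

theorem dvd_coeff_quintupleTheta_wronskian {p : ℕ} (hp : p.Prime) (h4 : p % 4 = 3) (h3 : 3 < p)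
    {m : ℕ} (hm : p ∣ 24 * m + 13) :
    (p : ℤ) ∣ coeff m (wronskianSeries (quintupleTheta (-1) 17 6) (quintupleTheta 5 11 2)) := by
  have q1 := natCast_quadExp (a := 12) (b := -1) (c := 0) (by norm_num) (by norm_num) (by norm_num)
  have q2 := natCast_quadExp (a := 12) (b := 17) (c := 6) (by norm_num) (by norm_num) (by norm_num)
  have q3 := natCast_quadExp (a := 12) (b := 5) (c := 0) (by norm_num) (by norm_num) (by norm_num)
  have q4 := natCast_quadExp (a := 12) (b := 11) (c := 2) (by norm_num) (by norm_num) (by norm_num)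
  have f1 := (finiteBelow_quadExp (a := 12) (b := -1) (c := 0) (by norm_num) (by norm_num)
    (by norm_num)).sumElim (finiteBelow_quadExp (a := 12) (b := 17) (c := 6) (by norm_num)
      (by norm_num) (by norm_num))
  have f2 := (finiteBelow_quadExp (a := 12) (b := 5) (c := 0) (by norm_num) (by norm_num)
    (by norm_num)).sumElim (finiteBelow_quadExp (a := 12) (b := 11) (c := 2) (by norm_num)
      (by norm_num) (by norm_num))
  rw [quintupleTheta, quintupleTheta, wronskianSeries_exponentSeries f1 f2, coeff_exponentSeries]
  refine finsum_induction (fun t : ℤ => (p : ℤ) ∣ t) (dvd_zero _) (fun _ _ => dvd_add) ?_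
  rintro ⟨i, j⟩
  split_ifs with hij
  swap
  · exact dvd_zero _
  refine Dvd.dvd.mul_left ?_ _
  simp only at hij ⊢
  -- Completing the square: both branches of each theta series have the same discriminant, hence the
  -- constants 1 and 25, with 1 + 25 = 2·13.
  obtain ⟨u, hu⟩ : ∃ u : ℤ, 48 * ((Sum.elim (quadExp 12 (-1) 0) (quadExp 12 17 6) i : ℕ) : ℤ) + 1 =
      u ^ 2 := by
    rcases i with k | k
    · exact ⟨24 * k - 1, by rw [Sum.elim_inl, q1]; ring⟩
    · exact ⟨24 * k + 17, by rw [Sum.elim_inr, q2]; ring⟩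
  obtain ⟨v, hv⟩ : ∃ v : ℤ, 48 * ((Sum.elim (quadExp 12 5 0) (quadExp 12 11 2) j : ℕ) : ℤ) + 25 =
      v ^ 2 := by
    rcases j with k | k
    · exact ⟨24 * k + 5, by rw [Sum.elim_inl, q3]; ring⟩
    · exact ⟨24 * k + 11, by rw [Sum.elim_inr, q4]; ring⟩
  generalize Sum.elim (quadExp 12 (-1) 0) (quadExp 12 17 6) i = a at hu hij ⊢
  generalize Sum.elim (quadExp 12 5 0) (quadExp 12 11 2) j = b at hv hij ⊢
  have hsum : (p : ℤ) ∣ u ^ 2 + v ^ 2 := by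
    have h5 : ((24 * m + 13 : ℕ) : ℤ) * 2 = u ^ 2 + v ^ 2 := by
      rw [← hu, ← hv, ← hij]
      push_cast
      ring
    rw [← h5]
    exact (Int.natCast_dvd_natCast.2 hm).mul_right 2
  have := Fact.mk hp
  have hzero : (u : ZMod p) ^ 2 = -(v : ZMod p) ^ 2 := by
    have h5 := (ZMod.intCast_zmod_eq_zero_iff_dvd (u ^ 2 + v ^ 2) p).2 hsum
    push_cast at h5
    linear_combination h5
  have hv0 : (v : ZMod p) = 0 := by
    by_contra h
    exact ZMod.mod_four_ne_three_of_sq_eq_neg_sq' h hzero h4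
  have hpv : (p : ℤ) ∣ v := (ZMod.intCast_zmod_eq_zero_iff_dvd v p).1 hv0
  have hpv2 : (p : ℤ) ∣ v ^ 2 := dvd_pow hpv two_ne_zero
  have h24 : (p : ℤ) ∣ 24 * (1 + 2 * ((b : ℤ) - a)) := by
    have h5 : 24 * (1 + 2 * ((b : ℤ) - a)) = 2 * v ^ 2 - (u ^ 2 + v ^ 2) := by
      rw [← hu, ← hv]
      ring
    rw [h5]
    exact dvd_sub (hpv2.mul_left 2) hsum
  rcases (Nat.prime_iff_prime_int.1 hp).dvd_or_dvd h24 with h | h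
  · have h5 : p ∣ 24 := by exact_mod_cast h
    have h6 : p ∣ 2 ^ 3 * 3 := by simpa using h5
    rcases hp.dvd_mul.1 h6 with h7 | h7
    · have := Nat.le_of_dvd two_pos (hp.dvd_of_dvd_pow h7)
      omega
    · have := Nat.le_of_dvd (by norm_num) h7
      omega
  · exact h

/-- Frobenius: g^p = g(X^p) over `ZMod p`. Truncation reduces this to the polynomial statement
`ZMod.expand_card`. -/
theorem dvd_coeff_pow_of_not_dvd {p : ℕ} (hp : p.Prime) (f : ℤ⟦X⟧) {m : ℕ} (hm : ¬ p ∣ m) :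
    (p : ℤ) ∣ coeff m (f ^ p) := by
  have := Fact.mk hp
  rw [← ZMod.intCast_zmod_eq_zero_iff_dvd]
  have h1 : ((coeff m (f ^ p) : ℤ) : ZMod p) =
      coeff m ((map (Int.castRingHom (ZMod p)) f) ^ p) := by
    rw [← map_pow, coeff_map]
    rfl
  set g := map (Int.castRingHom (ZMod p)) f
  have h2 : trunc (m + 1) ((trunc (m + 1) g : (ZMod p)⟦X⟧) ^ p) = trunc (m + 1) (g ^ p) :=
    trunc_trunc_pow g (m + 1) p
  have h3 := congrArg (fun t : Polynomial (ZMod p) => t.coeff m) h2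
  simp only [coeff_trunc, if_pos (Nat.lt_succ_self m)] at h3
  rw [← Polynomial.coe_pow, Polynomial.coeff_coe, ← ZMod.expand_card,
    Polynomial.coeff_expand hp.pos, if_neg hm] at h3
  rw [h1, ← h3]

/-- The place where c = p - 6 enters: f_2^p / (f_1 f_2^(c-1)) = f_2^7/f_1. -/
theorem cubicSeries_mul_eulerProd_pow {c p : ℕ} (hcp : c + 6 = p) (hc : 0 < c) :
    cubicSeries c * eulerProd 2 ^ p =
      wronskianSeries (quintupleTheta (-1) 17 6) (quintupleTheta 5 11 2) := by
  obtain ⟨d, rfl⟩ := Nat.exists_eq_succ_of_ne_zero hc.ne'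
  subst hcp
  have h1 := cubicSeries_mul_eulerProd d
  have h2 := eulerProd_one_mul_wronskianSeries
  calc _ = cubicSeries (d + 1) * eulerProd 2 ^ d * eulerProd 2 ^ 7 := by
        rw [Nat.succ_eq_add_one]
        ring
    _ = _ := by
        rw [← h2]
        linear_combination
          wronskianSeries (quintupleTheta (-1) 17 6) (quintupleTheta 5 11 2) * h1

theorem constantCoeff_eulerProd_pow (p : ℕ) : coeff 0 (eulerProd 2 ^ p) = 1 ∨
    coeff 0 (eulerProd 2 ^ p) = -1 := by
  have h1 := congrArg (constantCoeff (R := ℤ)) (cubicSeries_mul_eulerProd 1)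
  rw [map_mul, map_mul, map_one, map_pow, pow_one] at h1
  have h2 : IsUnit (constantCoeff (eulerProd 2)) :=
    IsUnit.of_mul_eq_one (constantCoeff (cubicSeries (1 + 1)) * constantCoeff (eulerProd 1))
      (by linear_combination h1)
  rw [coeff_zero_eq_constantCoeff_apply, map_pow]
  exact Int.isUnit_iff.1 (h2.pow p)

theorem generalizedCubicCount_modEq_zero {p c r : ℕ} (hp : p.Prime) (h4 : p % 4 = 3)
    (hcp : c + 6 = p) (hc : 0 < c) (hr : p ∣ 24 * r + 13) (hrp : r < p) (n : ℕ) :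
    generalizedCubicCount c (p * n + r) ≡ 0 [MOD p] := by
  rw [Nat.modEq_zero_iff_dvd, ← Int.natCast_dvd_natCast]
  induction n using Nat.strong_induction_on with
  | _ n ih =>
    have hdvd : p ∣ 24 * (p * n + r) + 13 := by
      have : 24 * (p * n + r) + 13 = p * (24 * n) + (24 * r + 13) := by ring
      rw [this]
      exact (dvd_mul_right _ _).add hr
    have h1 := dvd_coeff_quintupleTheta_wronskian hp h4 (by omega) hdvd
    rw [← cubicSeries_mul_eulerProd_pow hcp hc, coeff_mul,
      Finset.Nat.sum_antidiagonal_eq_sum_range_succ_mk, Finset.sum_range_succ, Nat.sub_self] at h1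
    have h2 : (p : ℤ) ∣ ∑ k ∈ Finset.range (p * n + r), coeff k (cubicSeries c) *
        coeff (p * n + r - k) (eulerProd 2 ^ p) := by
      refine Finset.dvd_sum fun k hk => ?_
      have hk' := Finset.mem_range.1 hk
      -- Either k = p(n - t) + r with t ≥ 1 and the induction hypothesis applies, or the coefficient
      -- of f_2^p vanishes mod p. Only the term k = pn + r remains, multiplied by a constant
      -- coefficient ±1.
      by_cases hd : p ∣ p * n + r - k
      · obtain ⟨t, ht⟩ := hd
        have ht0 : 0 < t := by
          rcases Nat.eq_zero_or_pos t with rfl | h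
          · omega
          · exact h
        -- Uses r < p: otherwise pt would exceed pn + r.
        have htn : t ≤ n := by
          by_contra h
          have : p * (n + 1) ≤ p * t := Nat.mul_le_mul_left p (by omega)
          rw [mul_add] at this
          omega
        have hk2 : k = p * (n - t) + r := by
          have : p * (n - t) + p * t = p * n := by rw [← mul_add, Nat.sub_add_cancel htn]
          omega
        rw [hk2, cubicSeries, coeff_mk]
        exact (ih (n - t) (by omega)).mul_right _
      · exact (dvd_coeff_pow_of_not_dvd hp _ hd).mul_left _
    have h3 := (dvd_add_right h2).1 h1
    rw [cubicSeries, coeff_mk] at h3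
    rcases constantCoeff_eulerProd_pow p with h | h
    · rwa [h, mul_one] at h3
    · rwa [h, mul_neg_one, dvd_neg] at h3

end Congruence

theorem theorem1 (n : ℕ) :
    generalizedCubicCount 37 (43 * n + 12) ≡ 0 [MOD 43] ∧
    generalizedCubicCount 41 (47 * n + 21) ≡ 0 [MOD 47] ∧
    generalizedCubicCount 53 (59 * n + 56) ≡ 0 [MOD 59] ∧
    generalizedCubicCount 61 (67 * n + 19) ≡ 0 [MOD 67] ∧
    generalizedCubicCount 65 (71 * n + 32) ≡ 0 [MOD 71] ∧
    generalizedCubicCount 73 (79 * n + 62) ≡ 0 [MOD 79] ∧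
    generalizedCubicCount 77 (83 * n + 79) ≡ 0 [MOD 83] := by
  refine ⟨?_, ?_, ?_, ?_, ?_, ?_, ?_⟩ <;>
    exact generalizedCubicCount_modEq_zero (by norm_num) (by norm_num) (by norm_num)
      (by norm_num) (by norm_num) (by norm_num) n
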